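/- **Setting.** Let $0<\alpha\le 1$, $F\subset\mathbb R$, and for $x\le y$ put $$\gamma^\alpha(F,x,y)=\lim_{\delta\to0^+}\ \inf_{|P|\le\delta}\ \sum_{i=0}^{n-1}\frac{(t_{i+1}-t_i)^\alpha}{\Gamma(\alpha+1)}\,\Theta(F,[t_i,t_{i+1}]),$$ where $P=\{x=t_0,\dots,t_n=y\}$ runs over the subdivisions of $[x,y]$ of mesh $|P|\le\delta$ and $\Theta(F,I)$ is $1$ if $F\cap I\ne\emptyset$ and $0$ otherwise. For a fixed $l\in\mathbb R$ let $S_F^\alpha(x)=\gamma^\alpha(F,l,x)$ if $x\ge l$ and $S_F^\alpha(x)=-\gamma^\alpha(F,x,l)$ if $x<l$. Assume that $F$ is $\alpha$-perfect, i.e. $\gamma^\alpha(F,x,y)<\infty$ for all $x\le y$, and $F$ is exactly the set of points $x$ such that $S_F^\alpha$ is not constant on any open interval containing $x$. Assume also $S_F^\alpha(0)=0$ (e.g. $l=0$) and $S_F^\alpha(t)\to\infty$ as $t\to\infty$. A function $h$ is *$F^\alpha$-integrable* on $[a,b]$ if it is bounded on $F\cap[a,b]$ and the supremum over all subdivisions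 of the lower sums $\sum_i \inf_{F\cap[t_i,t_{i+1}]}h\,\big(S_F^\alpha(t_{i+1})-S_F^\alpha(t_i)\big)$ equals the infimum of the upper sums, defined with $\sup$ in place of $\inf$ (either is read as $0$ if $F\cap[t_i,t_{i+1}]=\emptyset$); the common value is $\int_a^b h(t)\,d_F^\alpha t$, and $\int_0^\infty=\lim_{T\to\infty}\int_0^T$. For $f$ on $[0,\infty)$ and $x\ge 0$, put $$D_F^\alpha f(x)=\lim_{y\to x,\ y\in F,\ y\ge0,\ y\neq x}\frac{f(y)-f(x)}{S_F^\alpha(y)-S_F^\alpha(x)}\ \text{ if }x\in F,\qquad D_F^\alpha f(x)=0\ \text{ if }x\notin F.$$ (If $0$ is an isolated point of $F\cap[0,\infty)$, the value $D_F^\alpha f(0)$ is arbitrary and immaterial.) The *fractal Laplace* and *fractal Sumudu transforms* of $h$ at $v$ are $$\mathfrak L[h](v)=\int_0^\infty e^{-S_F^\alpha(v)S_F^\alpha(t)}h(t)\,d_F^\alpha t,\qquad \mathscr S[h](v)=\frac1{S_F^\alpha(v)}\int_0^\infty e^{-S_F^\alpha(t)/S_F^\alpha(v)}h(t)\,d_F^\alpha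 t\quad(S_F^\alpha(v)\ne0),$$ whenever the integrals over all $[0,T]$ and the limit as $T\to\infty$ exist. Let $0\le\gamma<1$, let $\mathcal N:\mathbb R\to\mathbb R$ satisfy $\mathcal N(0)=\mathcal N(1)=1$, and define the *wsk-fractal time derivative* (with initial time $0$) by $${}^{\mathrm{wsk}}\mathfrak D_F^\gamma f(t)=\frac{\mathcal N(\gamma)}{1-\gamma}\int_0^t e^{-\frac{\gamma(S_F^\alpha(t)-S_F^\alpha(\tau))}{1-\gamma}}\,D_F^\alpha f(\tau)\,d_F^\alpha\tau ,\qquad t\ge0.$$ **Theorem 3.4.** Let $f$ be a real function on $[0,\infty)$ that is a function of $S_F^\alpha(t)$ (i.e. $S_F^\alpha(x)=S_F^\alpha(y)$ implies $f(x)=f(y)$ for $x,y\ge0$), is $F^\alpha$-differentiable at every point of $F\cap[0,\infty)$, and whose derivative $D_F^\alpha f$ is $F^\alpha$-integrable on $[0,T]$ for every $T\ge0$. Then the integral defining ${}^{\mathrm{wsk}}\mathfrak D_F^\gamma f(t)$ exists for every $t\ge0$, and: 1. if $S_F^\alpha(v)+\frac{\gamma}{1-\gamma}>0$ and $\mathfrak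 L[f](v)$ exists, then $\mathfrak L[{}^{\mathrm{wsk}}\mathfrak D_F^\gamma f](v)$ exists and $$\mathfrak L\big[{}^{\mathrm{wsk}}\mathfrak D_F^\gamma f\big](v)=\frac{\mathcal N(\gamma)}{1-\gamma}\cdot\frac{S_F^\alpha(v)\,\mathfrak L[f](v)-f(0)}{S_F^\alpha(v)+\frac{\gamma}{1-\gamma}};$$ 2. if $S_F^\alpha(v)\ne0$, $\frac1{S_F^\alpha(v)}+\frac{\gamma}{1-\gamma}>0$ and $\mathscr S[f](v)$ exists, then $\mathscr S[{}^{\mathrm{wsk}}\mathfrak D_F^\gamma f](v)$ exists and $$\mathscr S\big[{}^{\mathrm{wsk}}\mathfrak D_F^\gamma f\big](v)=\frac{\mathcal N(\gamma)}{1-\gamma}\cdot\frac{\mathscr S[f](v)-f(0)}{1+\frac{\gamma}{1-\gamma}S_F^\alpha(v)}.$$ In particular both hold, where the transform of $f$ exists, for every $v$ with $S_F^\alpha(v)>0$. -/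

import Mathlib

open Filter Topology

/-- A subdivision `x = pt 0 ≤ pt 1 ≤ … ≤ pt n = y` of `[x, y]`; only the values `pt 0, …, pt n`
matter. Repeated points are harmless: they contribute zero to all the sums below. -/
structure Subdivision (x y : ℝ) where
  n : ℕ
  pt : ℕ → ℝ
  mono : ∀ i < n, pt i ≤ pt (i + 1)
  first : pt 0 = x
  last : pt n = y

/-- The mesh `max (pt (i+1) - pt i)` of the subdivision is at most `δ`. -/
def Subdivision.MeshLE {x y : ℝ} (P : Subdivision x y) (δ : ℝ) : Prop :=
  ∀ i < P.n, P.pt (i + 1) - P.pt i ≤ δ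

open Classical in
/-- The flag function `Θ(F, [x, y])`. -/
noncomputable def flag (F : Set ℝ) (x y : ℝ) : ℝ :=
  if (F ∩ Set.Icc x y).Nonempty then 1 else 0

/-- The sum `σ^α[F, P]`. -/
noncomputable def massSum (F : Set ℝ) (α : ℝ) {x y : ℝ} (P : Subdivision x y) : ℝ :=
  ∑ i ∈ Finset.range P.n,
    (P.pt (i + 1) - P.pt i) ^ α / Real.Gamma (α + 1) * flag F (P.pt i) (P.pt (i + 1))

/-- The coarse-grained mass `γ_δ^α(F, x, y)`. -/
noncomputable def coarseMass (F : Set ℝ) (α δ x y : ℝ) : ENNReal :=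
  ⨅ (P : Subdivision x y) (_ : P.MeshLE δ), ENNReal.ofReal (massSum F α P)

/-- The mass function `γ^α(F, x, y) ∈ [0, ∞]`, the limit of the coarse-grained mass as `δ → 0+`.
The coarse-grained mass is antitone in `δ`, so the limit is the supremum over `δ > 0`
(see `tendsto_coarseMass`). -/
noncomputable def fractalMass (F : Set ℝ) (α x y : ℝ) : ENNReal :=
  ⨆ δ ∈ Set.Ioi (0 : ℝ), coarseMass F α δ x y

theorem tendsto_coarseMass (F : Set ℝ) (α x y : ℝ) :
    Tendsto (fun δ => coarseMass F α δ x y) (𝓝[>] 0) (𝓝 (fractalMass F α x y)) := by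
  have h : Antitone (fun δ => coarseMass F α δ x y) := by
    intro δ₁ δ₂ hδ
    exact iInf_mono fun P => iInf_mono' fun hP => ⟨fun i hi => (hP i hi).trans hδ, le_rfl⟩
  have h2 := h.tendsto_nhdsGT (0 : ℝ)
  rwa [sSup_image] at h2

open Classical in
/-- The integral staircase function `S_F^α` with base point `l`. -/
noncomputable def staircase (F : Set ℝ) (α l x : ℝ) : ℝ :=
  if l ≤ x then (fractalMass F α l x).toReal else -(fractalMass F α x l).toReal

/-- The set of change of `g`: the points `x` such that `g` is not constant on any open interval
containing `x`. -/
def setOfChange (g : ℝ → ℝ) : Set ℝ :=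
  {x | ∀ c d : ℝ, c < x → x < d → ¬ ∃ k, ∀ y ∈ Set.Ioo c d, g y = k}

/-- `F` is `α`-perfect: the mass function is finite and `F` is the set of change of its
staircase function (whose set of change does not depend on the base point `l`). -/
def IsAlphaPerfect (F : Set ℝ) (α l : ℝ) : Prop :=
  (∀ x y : ℝ, x ≤ y → fractalMass F α x y ≠ ⊤) ∧ setOfChange (staircase F α l) = F

/-- The upper sum `∑ M[f, F, [x_i, x_{i+1}]] (S(x_{i+1}) - S(x_i))`, where `M[f, F, I]` is the
supremum of `f` over `F ∩ I`, and `0` if `F ∩ I` is empty. -/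
noncomputable def fractalUpperSum (F : Set ℝ) (α l : ℝ) (f : ℝ → ℝ) {a b : ℝ}
    (P : Subdivision a b) : ℝ :=
  ∑ i ∈ Finset.range P.n, sSup (f '' (F ∩ Set.Icc (P.pt i) (P.pt (i + 1)))) *
    (staircase F α l (P.pt (i + 1)) - staircase F α l (P.pt i))

/-- The lower sum, with the infimum of `f` over `F ∩ I` (and `0` if `F ∩ I` is empty). -/
noncomputable def fractalLowerSum (F : Set ℝ) (α l : ℝ) (f : ℝ → ℝ) {a b : ℝ}
    (P : Subdivision a b) : ℝ :=
  ∑ i ∈ Finset.range P.n, sInf (f '' (F ∩ Set.Icc (P.pt i) (P.pt (i + 1)))) *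
    (staircase F α l (P.pt (i + 1)) - staircase F α l (P.pt i))

/-- `f` is `F^α`-integrable on `[a, b]`, where `a ≤ b`: it is bounded on `F ∩ [a, b]`, and its
lower and upper `F^α`-integrals agree. -/
def FractalIntegrable (F : Set ℝ) (α l : ℝ) (f : ℝ → ℝ) (a b : ℝ) : Prop :=
  BddAbove (f '' (F ∩ Set.Icc a b)) ∧ BddBelow (f '' (F ∩ Set.Icc a b)) ∧
    (⨆ P : Subdivision a b, fractalLowerSum F α l f P) =
      ⨅ P : Subdivision a b, fractalUpperSum F α l f P

/-- The `F^α`-integral `∫_a^b f(t) d_F^α t` for `a ≤ b`; meaningful if `f` is `F^α`-integrable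
on `[a, b]`. -/
noncomputable def fractalIntegral (F : Set ℝ) (α l : ℝ) (f : ℝ → ℝ) (a b : ℝ) : ℝ :=
  ⨆ P : Subdivision a b, fractalLowerSum F α l f P

/-- At the point `x ∈ F`, the function `f` on the time domain `J` has `F^α`-derivative `d`: the
difference quotient with respect to the staircase function tends to `d` as `y → x` through
`F` (and within `J`). -/
def HasFractalDerivWithinAt (F : Set ℝ) (α l : ℝ) (J : Set ℝ) (f : ℝ → ℝ) (d x : ℝ) : Prop :=
  Tendsto (fun y => (f y - f x) / (staircase F α l y - staircase F α l x))
    (𝓝[(F ∩ J) \ {x}] x) (𝓝 d)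

open Classical in
/-- The `F^α`-derivative `D_F^α f` of a function on the time domain `J`: the limit above at the
points of `F`, and `0` off `F`. -/
noncomputable def fractalDerivWithin (F : Set ℝ) (α l : ℝ) (J : Set ℝ) (f : ℝ → ℝ) (x : ℝ) : ℝ :=
  if x ∈ F then
    limUnder (𝓝[(F ∩ J) \ {x}] x)
      (fun y => (f y - f x) / (staircase F α l y - staircase F α l x))
  else 0

/-- The integrand of the wsk-fractal derivative of `f : [a, ∞) → ℝ` at time `t`. -/
noncomputable def wskIntegrand (F : Set ℝ) (α l γ a : ℝ) (f : ℝ → ℝ) (t τ : ℝ) : ℝ :=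
  Real.exp (-(γ * (staircase F α l t - staircase F α l τ) / (1 - γ))) *
    fractalDerivWithin F α l (Set.Ici a) f τ

/-- The wsk-fractal time derivative of order `γ`, with normalisation function `N` and initial
time `a`. -/
noncomputable def wskDeriv (F : Set ℝ) (α l : ℝ) (N : ℝ → ℝ) (γ a : ℝ) (f : ℝ → ℝ) (t : ℝ) : ℝ :=
  N γ / (1 - γ) * fractalIntegral F α l (wskIntegrand F α l γ a f t) a t

/-- The fractal Laplace transform of `f` at `v` exists and equals `L`; the integral over
`[0, ∞)` is the limit of the `F^α`-integrals over `[0, T]` as `T → ∞`. -/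
def HasFractalLaplace (F : Set ℝ) (α l : ℝ) (f : ℝ → ℝ) (v L : ℝ) : Prop :=
  (∀ T, 0 ≤ T → FractalIntegrable F α l
    (fun t => Real.exp (-(staircase F α l v * staircase F α l t)) * f t) 0 T) ∧
  Tendsto (fun T => fractalIntegral F α l
    (fun t => Real.exp (-(staircase F α l v * staircase F α l t)) * f t) 0 T) atTop (𝓝 L)

/-- The fractal Sumudu transform of `f` at `v` exists and equals `L`. -/
def HasFractalSumudu (F : Set ℝ) (α l : ℝ) (f : ℝ → ℝ) (v L : ℝ) : Prop :=
  staircase F α l v ≠ 0 ∧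
  (∀ T, 0 ≤ T → FractalIntegrable F α l
    (fun t => Real.exp (-(staircase F α l t / staircase F α l v)) * f t) 0 T) ∧
  Tendsto (fun T => 1 / staircase F α l v * fractalIntegral F α l
    (fun t => Real.exp (-(staircase F α l t / staircase F α l v)) * f t) 0 T) atTop (𝓝 L)

/-!
The mass is additive over adjacent intervals and non-atomic, so the staircase function `S` is
continuous and monotone, and `u ↦ max {t | S t ≤ u}` is a right inverse of `S` with values in `F`.
Read through this inverse, `f` becomes a continuous function `g` of `u = S t` whose right derivative
is `D_F^α f`, and `F^α`-integrals become ordinary integrals in `u`. Integration by parts turns the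
wsk-derivative into `N(γ) / (1 - γ) * (g - q)`, where `κ = γ / (1 - γ)`, `q' = κ (g - q)` and
`q 0 = g 0`. Transforming this equation gives `(s + κ) q̂ = κ ĝ + g 0`, provided `e^{-sU} q(U) → 0`;
this boundary term vanishes by a continuous Kronecker lemma, so that convergence of `ĝ` replaces
any growth condition on `f`.
-/

namespace Subdivision

variable {x y z : ℝ}

theorem pt_le_pt (P : Subdivision x y) {i j : ℕ} (hij : i ≤ j) (hj : j ≤ P.n) :
    P.pt i ≤ P.pt j := by
  induction j, hij using Nat.le_induction with
  | base => exact le_rfl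
  | succ k _ ih => exact (ih (by lia)).trans (P.mono k (by lia))

theorem le_pt (P : Subdivision x y) {i : ℕ} (hi : i ≤ P.n) : x ≤ P.pt i :=
  P.first.symm.le.trans (P.pt_le_pt (Nat.zero_le i) hi)

theorem pt_le (P : Subdivision x y) {i : ℕ} (hi : i ≤ P.n) : P.pt i ≤ y :=
  (P.pt_le_pt hi le_rfl).trans P.last.le

/-- The sum of an interval function `W` over the pieces of a subdivision; the mass sums and the
lower and upper sums are of this form. -/
def sum (P : Subdivision x y) (W : ℝ → ℝ → ℝ) : ℝ :=
  ∑ i ∈ Finset.range P.n, W (P.pt i) (P.pt (i + 1))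

theorem sum_le_sum (P : Subdivision x y) {V W : ℝ → ℝ → ℝ}
    (h : ∀ i < P.n, V (P.pt i) (P.pt (i + 1)) ≤ W (P.pt i) (P.pt (i + 1))) : P.sum V ≤ P.sum W :=
  Finset.sum_le_sum fun i hi => h i (Finset.mem_range.1 hi)

theorem sum_sub (P : Subdivision x y) (g : ℝ → ℝ) : P.sum (fun u v => g v - g u) = g y - g x := by
  simp only [sum, Finset.sum_range_sub (fun i => g (P.pt i)), P.first, P.last]

/-- The subdivision of `[x, x]` without pieces. -/
def trivial (x : ℝ) : Subdivision x x where
  n := 0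
  pt _ := x
  mono _ _ := le_rfl
  first := rfl
  last := rfl

/-- The subdivision of `[x, y]` into a single piece. -/
def single (x y : ℝ) (h : x ≤ y) : Subdivision x y where
  n := 1
  pt k := if k = 0 then x else y
  mono i hi := by simpa [Nat.lt_one_iff.1 hi] using h
  first := if_pos rfl
  last := if_neg one_ne_zero

theorem sum_single (h : x ≤ y) (W : ℝ → ℝ → ℝ) : (single x y h).sum W = W x y := by
  simp [single, sum]

theorem meshLE_single (h : x ≤ y) : (single x y h).MeshLE (y - x) := fun i hi => by
  simp [single, Nat.lt_one_iff.1 hi]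

/-- The subdivision of `[x, y]` into `m + 1` pieces of equal length. -/
noncomputable def uniform (x y : ℝ) (h : x ≤ y) (m : ℕ) : Subdivision x y where
  n := m + 1
  pt k := x + k * ((y - x) / (m + 1))
  mono i _ := by
    have : 0 ≤ (y - x) / (m + 1) := div_nonneg (sub_nonneg.2 h) (by positivity)
    push_cast
    linarith
  first := by simp
  last := by
    push_cast
    field_simp
    ring

theorem meshLE_uniform (h : x ≤ y) (m : ℕ) : (uniform x y h m).MeshLE ((y - x) / (m + 1)) := by
  intro i _
  simp only [uniform]
  push_cast
  linarith

theorem exists_meshLE (h : x ≤ y) {δ : ℝ} (hδ : 0 < δ) : ∃ P : Subdivision x y, P.MeshLE δ := by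
  obtain ⟨m, hm⟩ := exists_nat_gt ((y - x) / δ)
  refine ⟨uniform x y h m, fun i hi => (meshLE_uniform h m i hi).trans ?_⟩
  rw [div_lt_iff₀ hδ] at hm
  rw [div_le_iff₀ (by positivity)]
  linarith

/-- Juxtaposition of subdivisions of adjacent intervals. -/
def append (P : Subdivision x y) (Q : Subdivision y z) : Subdivision x z where
  n := P.n + Q.n
  pt k := if k ≤ P.n then P.pt k else Q.pt (k - P.n)
  mono i hi := by
    rcases lt_trichotomy i P.n with h | rfl | h
    · rw [if_pos h.le, if_pos (by lia : i + 1 ≤ P.n)]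
      exact P.mono i h
    · rw [if_pos le_rfl, if_neg (by lia), P.last]
      exact Q.le_pt (by lia)
    · rw [if_neg (by lia : ¬ i ≤ P.n), if_neg (by lia : ¬ i + 1 ≤ P.n),
        show i + 1 - P.n = i - P.n + 1 by lia]
      exact Q.mono _ (by lia)
  first := by simp [P.first]
  last := by
    rcases Nat.eq_zero_or_pos Q.n with h | h
    · have hyz := Q.last
      rw [h, Q.first] at hyz
      rw [h, add_zero, if_pos le_rfl, P.last, hyz]
    · rw [if_neg (by lia), Nat.add_sub_cancel_left, Q.last]

theorem append_pt_of_le (P : Subdivision x y) (Q : Subdivision y z) {k : ℕ} (hk : k ≤ P.n) :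
    (P.append Q).pt k = P.pt k := if_pos hk

theorem append_pt_add (P : Subdivision x y) (Q : Subdivision y z) (k : ℕ) :
    (P.append Q).pt (P.n + k) = Q.pt k := by
  rcases Nat.eq_zero_or_pos k with rfl | hk
  · rw [add_zero, append_pt_of_le _ _ le_rfl, P.last, Q.first]
  · exact (if_neg (by lia)).trans (by rw [Nat.add_sub_cancel_left])

theorem sum_append (P : Subdivision x y) (Q : Subdivision y z) (W : ℝ → ℝ → ℝ) :
    (P.append Q).sum W = P.sum W + Q.sum W := by
  change ∑ i ∈ Finset.range (P.n + Q.n), _ = _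
  rw [Finset.sum_range_add]
  congr 1
  · refine Finset.sum_congr rfl fun i hi => ?_
    have := Finset.mem_range.1 hi
    rw [append_pt_of_le _ _ this.le, append_pt_of_le _ _ this]
  · exact Finset.sum_congr rfl fun i _ => by rw [add_assoc, append_pt_add, append_pt_add]

theorem MeshLE.append {P : Subdivision x y} {Q : Subdivision y z} {δ : ℝ} (hP : P.MeshLE δ)
    (hQ : Q.MeshLE δ) : (P.append Q).MeshLE δ := by
  intro i (hi : i < P.n + Q.n)
  rcases lt_or_ge i P.n with h | h
  · rw [append_pt_of_le _ _ h.le, append_pt_of_le _ _ h]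
    exact hP i h
  · obtain ⟨k, rfl⟩ := Nat.exists_eq_add_of_le h
    rw [add_assoc, append_pt_add, append_pt_add]
    exact hQ k (by lia)

/-- The restriction of a subdivision of `[x, z]` to `[x, y]`; the points beyond `y` collapse
to `y`. -/
def clampRight (P : Subdivision x z) (y : ℝ) (hxy : x ≤ y) (hyz : y ≤ z) : Subdivision x y where
  n := P.n
  pt k := min (P.pt k) y
  mono i hi := min_le_min_right y (P.mono i hi)
  first := by rw [P.first, min_eq_left hxy]
  last := by rw [P.last, min_eq_right hyz]

/-- The restriction of a subdivision of `[x, z]` to `[y, z]`; the points before `y` collapse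
to `y`. -/
def clampLeft (P : Subdivision x z) (y : ℝ) (hxy : x ≤ y) (hyz : y ≤ z) : Subdivision y z where
  n := P.n
  pt k := max (P.pt k) y
  mono i hi := max_le_max_right y (P.mono i hi)
  first := by rw [P.first, max_eq_right hxy]
  last := by rw [P.last, max_eq_left hyz]

theorem MeshLE.clampRight {P : Subdivision x z} {δ : ℝ} (hP : P.MeshLE δ) (hxy : x ≤ y)
    (hyz : y ≤ z) : (P.clampRight y hxy hyz).MeshLE δ := fun i hi => by
  have := P.mono i hi
  have := hP i hi
  change min _ _ - min _ _ ≤ δ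
  grind

theorem MeshLE.clampLeft {P : Subdivision x z} {δ : ℝ} (hP : P.MeshLE δ) (hxy : x ≤ y)
    (hyz : y ≤ z) : (P.clampLeft y hxy hyz).MeshLE δ := fun i hi => by
  have := P.mono i hi
  have := hP i hi
  change max _ _ - max _ _ ≤ δ
  grind

theorem sum_clampRight_add_sum_clampLeft (P : Subdivision x z) (hxy : x ≤ y) (hyz : y ≤ z)
    (W : ℝ → ℝ → ℝ) :
    (P.clampRight y hxy hyz).sum W + (P.clampLeft y hxy hyz).sum W =
      P.sum fun p q => W (min p y) (min q y) + W (max p y) (max q y) :=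
  Finset.sum_add_distrib.symm

theorem add_min_max_eq_ite {W : ℝ → ℝ → ℝ} {p q : ℝ} (hW : W y y = 0) (hpq : p ≤ q) :
    W (min p y) (min q y) + W (max p y) (max q y) =
      if p < y ∧ y < q then W p y + W y q else W p q := by
  rcases le_or_gt q y with hq | hq
  · rw [min_eq_left hq, min_eq_left (hpq.trans hq), max_eq_right hq, max_eq_right (hpq.trans hq),
      hW, add_zero, if_neg fun h => h.2.not_ge hq]
  · rcases le_or_gt y p with hp | hp
    · rw [min_eq_right hq.le, min_eq_right hp, max_eq_left hq.le, max_eq_left hp, hW, zero_add,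
        if_neg fun h => h.1.not_ge hp]
    · rw [min_eq_right hq.le, min_eq_left hp.le, max_eq_left hq.le, max_eq_right hp.le,
        if_pos ⟨hp, hq⟩]

end Subdivision

/-- An interval function on `[x, y]` whose sums over subdivisions can only grow when a piece is
cut in two; the contributions to a lower sum are the main example. -/
structure CutSubadditiveOn (W : ℝ → ℝ → ℝ) (x y : ℝ) : Prop where
  self : ∀ u, W u u = 0
  cut : ∀ u v w, x ≤ u → u ≤ v → v ≤ w → w ≤ y → W u w ≤ W u v + W v w

namespace CutSubadditiveOn

variable {W : ℝ → ℝ → ℝ} {x y s t : ℝ}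

theorem mono (hW : CutSubadditiveOn W x y) (hs : x ≤ s) (ht : t ≤ y) : CutSubadditiveOn W s t :=
  ⟨hW.self, fun u v w hu huv hvw hw => hW.cut u v w (hs.trans hu) huv hvw (hw.trans ht)⟩

theorem le_sum (hW : CutSubadditiveOn W x y) (P : Subdivision x y) : W x y ≤ P.sum W := by
  have hprefix : ∀ j ≤ P.n, W x (P.pt j) ≤ ∑ i ∈ Finset.range j, W (P.pt i) (P.pt (i + 1)) := by
    intro j
    induction j with
    | zero => simp [P.first, hW.self]
    | succ j ih =>
      intro hj
      rw [Finset.sum_range_succ]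
      have := hW.cut x _ _ le_rfl (P.le_pt (by lia : j ≤ P.n)) (P.mono j hj) (P.pt_le hj)
      linarith [ih (by lia)]
  simpa only [P.last, Subdivision.sum] using hprefix P.n le_rfl

theorem sum_min_le (hW : CutSubadditiveOn W x y) (Q : Subdivision x y) (hxs : x ≤ s) (hst : s ≤ t)
    (hty : t ≤ y) :
    Q.sum (fun p q => W (min p t) (min q t)) ≤ Q.sum (fun p q => W (min p s) (min q s)) +
      ((Q.clampRight t (hxs.trans hst) hty).clampLeft s hxs hst).sum W := by
  set R := Q.clampRight t (hxs.trans hst) hty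
  have hR : (R.clampRight s hxs hst).sum W = Q.sum fun p q => W (min p s) (min q s) := by
    simp only [R, Subdivision.sum, Subdivision.clampRight, min_assoc, min_eq_right hst]
  change R.sum W ≤ _
  rw [← hR, R.sum_clampRight_add_sum_clampLeft]
  refine R.sum_le_sum fun i hi => ?_
  rw [Subdivision.add_min_max_eq_ite (hW.self s) (R.mono i hi)]
  split_ifs with h
  · exact hW.cut _ _ _ (R.le_pt hi.le) h.1.le h.2.le ((R.pt_le hi).trans hty)
  · exact le_rfl

end CutSubadditiveOn

theorem Subdivision.exists_common_refinement {x y : ℝ} (P Q : Subdivision x y) :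
    ∃ R : Subdivision x y, (∀ δ, Q.MeshLE δ → R.MeshLE δ) ∧
      ∀ W, CutSubadditiveOn W x y → P.sum W ≤ R.sum W ∧ Q.sum W ≤ R.sum W := by
  have hprefix : ∀ j ≤ P.n, ∃ R : Subdivision x (P.pt j), (∀ δ, Q.MeshLE δ → R.MeshLE δ) ∧
      ∀ W, CutSubadditiveOn W x y →
        ∑ i ∈ Finset.range j, W (P.pt i) (P.pt (i + 1)) ≤ R.sum W ∧
        Q.sum (fun p q => W (min p (P.pt j)) (min q (P.pt j))) ≤ R.sum W := by
    intro j
    induction j with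
    | zero =>
      intro _
      rw [P.first]
      refine ⟨trivial x, fun δ _ i hi => absurd hi (Nat.not_lt_zero i), fun W hW => ?_⟩
      have hQ : Q.sum (fun p q => W (min p x) (min q x)) = 0 :=
        Finset.sum_eq_zero fun i hi => by
          have hi := Finset.mem_range.1 hi
          beta_reduce
          rw [min_eq_right (Q.le_pt hi.le), min_eq_right (Q.le_pt hi), hW.self]
      rw [hQ]
      simp [trivial, sum]
    | succ j ih =>
      intro hj
      have hx : x ≤ P.pt j := P.le_pt (by lia)
      have hmono : P.pt j ≤ P.pt (j + 1) := P.mono j hj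
      have hy : P.pt (j + 1) ≤ y := P.pt_le hj
      obtain ⟨R, hmesh, hR⟩ := ih (by lia)
      refine ⟨R.append ((Q.clampRight _ (hx.trans hmono) hy).clampLeft _ hx hmono),
        fun δ hδ => (hmesh δ hδ).append ((hδ.clampRight _ _).clampLeft _ _), fun W hW => ?_⟩
      rw [sum_append, Finset.sum_range_succ]
      exact ⟨add_le_add (hR W hW).1 ((hW.mono hx hy).le_sum _),
        (hW.sum_min_le Q hx hmono hy).trans (add_le_add_left (hR W hW).2 _)⟩
  have hQ : ∀ W : ℝ → ℝ → ℝ, Q.sum (fun p q => W (min p y) (min q y)) = Q.sum W := fun W =>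
    Finset.sum_congr rfl fun i hi => by
      have hi := Finset.mem_range.1 hi
      beta_reduce
      rw [min_eq_left (Q.pt_le hi.le), min_eq_left (Q.pt_le hi)]
  have hP := hprefix P.n le_rfl
  rw [P.last] at hP
  simp only [hQ] at hP
  exact hP

section Mass

variable {F : Set ℝ} {α δ x y z : ℝ}

/-- The contribution of a single interval to `massSum`. -/
noncomputable def pieceMass (F : Set ℝ) (α x y : ℝ) : ℝ :=
  (y - x) ^ α / Real.Gamma (α + 1) * flag F x y

theorem massSum_eq_sum (P : Subdivision x y) : massSum F α P = P.sum (pieceMass F α) := rfl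

theorem flag_nonneg (F : Set ℝ) (x y : ℝ) : 0 ≤ flag F x y := by
  unfold flag
  split_ifs <;> norm_num

theorem flag_le_one (F : Set ℝ) (x y : ℝ) : flag F x y ≤ 1 := by
  unfold flag
  split_ifs <;> norm_num

theorem flag_le_flag (F : Set ℝ) (hyz : y ≤ z) : flag F x y ≤ flag F x z := by
  unfold flag
  split_ifs with h h'
  · exact le_rfl
  · exact absurd (h.mono (Set.inter_subset_inter_right F (Set.Icc_subset_Icc_right hyz))) h'
  · exact zero_le_one
  · exact le_rfl

theorem rpow_div_Gamma_nonneg (hα : 0 < α) (hδ : 0 ≤ δ) : 0 ≤ δ ^ α / Real.Gamma (α + 1) :=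
  div_nonneg (Real.rpow_nonneg hδ α) (Real.Gamma_pos_of_pos (by linarith)).le

theorem rpow_div_Gamma_le_rpow_div_Gamma (hα : 0 < α) (hxy : x ≤ y) (hδ : y - x ≤ δ) :
    (y - x) ^ α / Real.Gamma (α + 1) ≤ δ ^ α / Real.Gamma (α + 1) := by
  have := Real.Gamma_pos_of_pos (show 0 < α + 1 by linarith)
  have := sub_nonneg.2 hxy
  gcongr

theorem pieceMass_nonneg (hα : 0 < α) (hxy : x ≤ y) : 0 ≤ pieceMass F α x y :=
  mul_nonneg (rpow_div_Gamma_nonneg hα (sub_nonneg.2 hxy)) (flag_nonneg F x y)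

theorem pieceMass_self (hα : α ≠ 0) (x : ℝ) : pieceMass F α x x = 0 := by
  simp [pieceMass, Real.zero_rpow hα]

theorem pieceMass_le_pieceMass (hα : 0 < α) (hxy : x ≤ y) (hyz : y ≤ z) :
    pieceMass F α x y ≤ pieceMass F α x z :=
  mul_le_mul (rpow_div_Gamma_le_rpow_div_Gamma hα hxy (by linarith)) (flag_le_flag F hyz)
    (flag_nonneg F x y) (rpow_div_Gamma_nonneg hα (by linarith))

theorem pieceMass_le (hα : 0 < α) (hxy : x ≤ y) (hδ : y - x ≤ δ) :
    pieceMass F α x y ≤ δ ^ α / Real.Gamma (α + 1) :=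
  (mul_le_of_le_one_right (rpow_div_Gamma_nonneg hα (sub_nonneg.2 hxy)) (flag_le_one F x y)).trans
    (rpow_div_Gamma_le_rpow_div_Gamma hα hxy hδ)

theorem massSum_nonneg (hα : 0 < α) (P : Subdivision x y) : 0 ≤ massSum F α P :=
  Finset.sum_nonneg fun i hi => pieceMass_nonneg hα (P.mono i (Finset.mem_range.1 hi))

theorem coarseMass_le {P : Subdivision x y} (hP : P.MeshLE δ) :
    coarseMass F α δ x y ≤ ENNReal.ofReal (massSum F α P) := iInf₂_le P hP

theorem coarseMass_le_add (F : Set ℝ) (α δ x y z : ℝ) :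
    coarseMass F α δ x z ≤ coarseMass F α δ x y + coarseMass F α δ y z := by
  refine ENNReal.le_iInf₂_add_iInf₂ fun P hP Q hQ => (coarseMass_le (hP.append hQ)).trans ?_
  rw [massSum_eq_sum, Subdivision.sum_append]
  exact ENNReal.ofReal_add_le

/-- The piece cut at `y` is counted twice; its right half costs at most the mass of a full piece,
accounted for by the jump of a step function at `y`. -/
theorem massSum_clampRight_add_massSum_clampLeft_le (hα : 0 < α) (hδ : 0 ≤ δ) (hxy : x ≤ y)
    (hyz : y ≤ z) {P : Subdivision x z} (hP : P.MeshLE δ) :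
    massSum F α (P.clampRight y hxy hyz) + massSum F α (P.clampLeft y hxy hyz) ≤
      massSum F α P + δ ^ α / Real.Gamma (α + 1) := by
  classical
  have hK : 0 ≤ δ ^ α / Real.Gamma (α + 1) := rpow_div_Gamma_nonneg hα hδ
  set K := δ ^ α / Real.Gamma (α + 1)
  let χ : ℝ → ℝ := fun t => if y ≤ t then K else 0
  have hχ : χ z - χ x ≤ K := by grind
  calc massSum F α (P.clampRight y hxy hyz) + massSum F α (P.clampLeft y hxy hyz)
    _ ≤ P.sum fun p q => pieceMass F α p q + (χ q - χ p) := by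
        rw [massSum_eq_sum, massSum_eq_sum, P.sum_clampRight_add_sum_clampLeft hxy hyz]
        refine P.sum_le_sum fun i hi => ?_
        have hmono := P.mono i hi
        rw [Subdivision.add_min_max_eq_ite (pieceMass_self hα.ne' y) hmono]
        split_ifs with h
        · have hleft := pieceMass_le_pieceMass (F := F) hα h.1.le h.2.le
          have hright := pieceMass_le (F := F) hα h.2.le (by linarith [hP i hi] : _ ≤ δ)
          grind
        · grind
    _ = massSum F α P + (χ z - χ x) := by
        rw [← P.sum_sub χ, massSum_eq_sum]
        exact Finset.sum_add_distrib
    _ ≤ massSum F α P + K := by gcongr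

theorem coarseMass_add_le (hα : 0 < α) (hδ : 0 ≤ δ) (hxy : x ≤ y) (hyz : y ≤ z) :
    coarseMass F α δ x y + coarseMass F α δ y z ≤
      coarseMass F α δ x z + ENNReal.ofReal (δ ^ α / Real.Gamma (α + 1)) := by
  conv_rhs => unfold coarseMass
  simp_rw [ENNReal.iInf_add]
  refine le_iInf₂ fun P hP => ?_
  calc coarseMass F α δ x y + coarseMass F α δ y z
    _ ≤ ENNReal.ofReal (massSum F α (P.clampRight y hxy hyz)) +
          ENNReal.ofReal (massSum F α (P.clampLeft y hxy hyz)) :=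
        add_le_add (coarseMass_le (hP.clampRight hxy hyz)) (coarseMass_le (hP.clampLeft hxy hyz))
    _ ≤ _ := by
        rw [← ENNReal.ofReal_add (massSum_nonneg hα _) (massSum_nonneg hα _),
          ← ENNReal.ofReal_add (massSum_nonneg hα _) (rpow_div_Gamma_nonneg hα hδ)]
        exact ENNReal.ofReal_le_ofReal
          (massSum_clampRight_add_massSum_clampLeft_le hα hδ hxy hyz hP)

theorem tendsto_ofReal_rpow_div_Gamma (hα : 0 < α) :
    Tendsto (fun δ : ℝ => ENNReal.ofReal (δ ^ α / Real.Gamma (α + 1))) (𝓝 0) (𝓝 0) := by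
  have h := (Real.continuousAt_rpow_const 0 α (Or.inr hα.le)).tendsto
  rw [Real.zero_rpow hα.ne'] at h
  simpa using ENNReal.tendsto_ofReal (h.div_const (Real.Gamma (α + 1)))

theorem fractalMass_add (hα : 0 < α) (hxy : x ≤ y) (hyz : y ≤ z) :
    fractalMass F α x y + fractalMass F α y z = fractalMass F α x z := by
  have hadd := (tendsto_coarseMass F α x y).add (tendsto_coarseMass F α y z)
  have hxz := tendsto_coarseMass F α x z
  have herror := (tendsto_ofReal_rpow_div_Gamma hα).mono_left (nhdsWithin_le_nhds (s := Set.Ioi 0))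
  refine le_antisymm ?_ (le_of_tendsto_of_tendsto hxz hadd
    (Eventually.of_forall fun δ => coarseMass_le_add F α δ x y z))
  simpa only [add_zero] using le_of_tendsto_of_tendsto hadd (hxz.add herror)
    (eventually_mem_nhdsWithin.mono fun δ (hδ : 0 < δ) => coarseMass_add_le hα hδ.le hxy hyz)

theorem coarseMass_le_rpow (hα : 0 < α) (hxy : x ≤ y) (hδ : y - x ≤ δ) :
    coarseMass F α δ x y ≤ ENNReal.ofReal ((y - x) ^ α / Real.Gamma (α + 1)) := by
  refine (coarseMass_le (P := Subdivision.single x y hxy)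
    fun i hi => (Subdivision.meshLE_single hxy i hi).trans hδ).trans ?_
  rw [massSum_eq_sum, Subdivision.sum_single]
  exact ENNReal.ofReal_le_ofReal (pieceMass_le hα hxy le_rfl)

theorem coarseMass_le_fractalMass (hδ : 0 < δ) : coarseMass F α δ x y ≤ fractalMass F α x y :=
  le_iSup₂ (f := fun δ (_ : δ ∈ Set.Ioi (0 : ℝ)) => coarseMass F α δ x y) δ hδ

/-- The coarse mass at scale `δ` charges a short interval `[y, z]` only its length to the `α`, so
the mass of `[y, z]` comes on top of it. -/
theorem coarseMass_add_fractalMass_le {w : ℝ} (hα : 0 < α) (hδ : 0 < δ) (hxy : x ≤ y) (hyz : y ≤ z)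
    (hzw : z ≤ w) (hlen : z - y ≤ δ) :
    coarseMass F α δ x w + fractalMass F α y z ≤
      fractalMass F α x w + ENNReal.ofReal ((z - y) ^ α / Real.Gamma (α + 1)) := by
  rw [← fractalMass_add hα hxy (hyz.trans hzw), ← fractalMass_add hα hyz hzw]
  calc coarseMass F α δ x w + fractalMass F α y z
    _ ≤ coarseMass F α δ x y + (coarseMass F α δ y z + coarseMass F α δ z w) +
          fractalMass F α y z := by
        gcongr
        exact (coarseMass_le_add F α δ x y w).trans
          (add_le_add_right (coarseMass_le_add F α δ y z w) _)
    _ ≤ fractalMass F α x y + (ENNReal.ofReal ((z - y) ^ α / Real.Gamma (α + 1)) +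
          fractalMass F α z w) + fractalMass F α y z := by
        gcongr
        · exact coarseMass_le_fractalMass hδ
        · exact coarseMass_le_rpow hα hyz hlen
        · exact coarseMass_le_fractalMass hδ
    _ = _ := by ring

theorem exists_fractalMass_lt (hα : 0 < α) {c : ENNReal} (hc : c ≠ 0)
    (hfin : fractalMass F α (x - 1) (x + 1) ≠ ⊤) :
    ∃ h > 0, fractalMass F α (x - h) (x + h) < c := by
  set M := fractalMass F α (x - 1) (x + 1)
  by_contra! hlarge
  have hcM : c ≤ M := hlarge 1 one_pos
  have hcoarse : ∀ δ ∈ Set.Ioi (0 : ℝ), coarseMass F α δ (x - 1) (x + 1) ≤ M - c := by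
    intro δ (hδ : 0 < δ)
    have hlen : Tendsto (fun h : ℝ => x + h - (x - h)) (𝓝[>] 0) (𝓝 0) :=
      tendsto_nhdsWithin_of_tendsto_nhds (Continuous.tendsto' (by fun_prop) _ _ (by simp))
    have hbound := ((tendsto_ofReal_rpow_div_Gamma hα).comp hlen).const_add M
    rw [add_zero] at hbound
    refine ENNReal.le_sub_of_add_le_right (ne_top_of_le_ne_top hfin hcM) (ge_of_tendsto hbound ?_)
    filter_upwards [self_mem_nhdsWithin, nhdsWithin_le_nhds (eventually_le_nhds one_pos),
      hlen.eventually (eventually_le_nhds hδ)] with h (h0 : 0 < h) h1 hδ'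
    exact (add_le_add_right (hlarge h h0) _).trans
      (coarseMass_add_fractalMass_le hα hδ (by linarith) (by linarith) (by linarith) hδ')
  exact (ENNReal.sub_lt_self hfin (ne_bot_of_le_ne_bot hc hcM) hc).not_ge (iSup₂_le hcoarse)

end Mass

section Staircase

variable {F : Set ℝ} {α l x y : ℝ}

theorem staircase_sub (hα : 0 < α) (hfin : ∀ x y : ℝ, x ≤ y → fractalMass F α x y ≠ ⊤)
    (hxy : x ≤ y) :
    staircase F α l y - staircase F α l x = (fractalMass F α x y).toReal := by
  have hadd : ∀ {a b c : ℝ}, a ≤ b → b ≤ c → (fractalMass F α a c).toReal =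
      (fractalMass F α a b).toReal + (fractalMass F α b c).toReal := fun {a b c} hab hbc => by
    rw [← ENNReal.toReal_add (hfin _ _ hab) (hfin _ _ hbc), fractalMass_add hα hab hbc]
  unfold staircase
  rcases le_or_gt l x with hlx | hxl
  · rw [if_pos hlx, if_pos (hlx.trans hxy), hadd hlx hxy]
    ring
  · rw [if_neg hxl.not_ge]
    split_ifs with hly
    · rw [hadd hxl.le hly]
      ring
    · rw [hadd hxy (not_le.1 hly).le]
      ring

theorem staircase_monotone (hα : 0 < α) (hfin : ∀ x y : ℝ, x ≤ y → fractalMass F α x y ≠ ⊤) :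
    Monotone (staircase F α l) := fun x y hxy => by
  rw [← sub_nonneg, staircase_sub hα hfin hxy]
  exact ENNReal.toReal_nonneg

theorem staircase_continuous (hα : 0 < α) (hfin : ∀ x y : ℝ, x ≤ y → fractalMass F α x y ≠ ⊤) :
    Continuous (staircase F α l) := by
  have hmono := staircase_monotone (l := l) hα hfin
  refine Metric.continuous_iff.2 fun x ε hε => ?_
  obtain ⟨h, h0, hmass⟩ := exists_fractalMass_lt (x := x) hα (ENNReal.ofReal_pos.2 hε).ne'
    (hfin _ _ (by linarith))
  refine ⟨h, h0, fun y hy => ?_⟩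
  rw [Real.dist_eq, abs_lt] at hy
  have hle := hmono (by linarith : x - h ≤ y)
  have hge := hmono (by linarith : y ≤ x + h)
  have hlex := hmono (by linarith : x - h ≤ x)
  have hgex := hmono (by linarith : x ≤ x + h)
  have hsub : staircase F α l (x + h) - staircase F α l (x - h) < ε := by
    rw [staircase_sub hα hfin (by linarith)]
    exact ENNReal.toReal_lt_of_lt_ofReal hmass
  rw [Real.dist_eq, abs_lt]
  constructor <;> linarith

end Staircase

/-- The properties of the staircase function `S` of a set `F`, normalised at `0`, on which the
change of variables `u = S t` rests. -/
structure IsStaircase (F : Set ℝ) (S : ℝ → ℝ) : Prop where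
  mono : Monotone S
  cont : Continuous S
  change : setOfChange S ⊆ F
  zero : S 0 = 0
  top : Tendsto S atTop atTop

/-- The right inverse of the staircase function `S` that picks the largest point of each level
`u ≥ 0`; it is extended by its value at `0` to the left. -/
noncomputable def levelMax (S : ℝ → ℝ) (u : ℝ) : ℝ := sSup {t | S t ≤ max u 0}

namespace IsStaircase

variable {F : Set ℝ} {S : ℝ → ℝ} {t u x y : ℝ}

theorem nonneg (hS : IsStaircase F S) (ht : 0 ≤ t) : 0 ≤ S t := hS.zero ▸ hS.mono ht

theorem bddAbove_setOf_le (hS : IsStaircase F S) (u : ℝ) : BddAbove {t | S t ≤ u} := by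
  obtain ⟨M, hM⟩ := (hS.top.eventually_gt_atTop u).exists
  exact ⟨M, fun t (ht : S t ≤ u) => le_of_not_gt fun h => (ht.trans_lt hM).not_ge (hS.mono h.le)⟩

theorem le_levelMax (hS : IsStaircase F S) (h : S t ≤ max u 0) : t ≤ levelMax S u :=
  le_csSup (hS.bddAbove_setOf_le _) h

theorem levelMax_nonneg (hS : IsStaircase F S) (u : ℝ) : 0 ≤ levelMax S u :=
  hS.le_levelMax (hS.zero.trans_le (le_max_right u 0))

theorem apply_levelMax_eq_max (hS : IsStaircase F S) (u : ℝ) : S (levelMax S u) = max u 0 := by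
  have hbelow : S 0 ≤ max u 0 := hS.zero.trans_le (le_max_right u 0)
  obtain ⟨M, hM⟩ := (hS.top.eventually_ge_atTop (max u 0)).exists
  obtain ⟨t, ht⟩ := mem_range_of_exists_le_of_exists_ge hS.cont ⟨0, hbelow⟩ ⟨M, hM⟩
  refine le_antisymm ?_ (ht ▸ hS.mono (hS.le_levelMax ht.le))
  exact (isClosed_le hS.cont continuous_const).csSup_mem ⟨0, hbelow⟩ (hS.bddAbove_setOf_le _)

theorem apply_levelMax (hS : IsStaircase F S) (hu : 0 ≤ u) : S (levelMax S u) = u := by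
  rw [hS.apply_levelMax_eq_max, max_eq_left hu]

theorem levelMax_mono (hS : IsStaircase F S) : Monotone (levelMax S) := fun u _ huv =>
  hS.le_levelMax ((hS.apply_levelMax_eq_max u).trans_le (max_le_max_right 0 huv))

theorem tendsto_levelMax_atTop (hS : IsStaircase F S) : Tendsto (levelMax S) atTop atTop :=
  tendsto_atTop.2 fun M => (eventually_ge_atTop (S M)).mono fun u hu =>
    hS.le_levelMax (hu.trans (le_max_left u 0))

theorem levelMax_mem (hS : IsStaircase F S) (u : ℝ) : levelMax S u ∈ F := by
  refine hS.change ?_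
  rintro c d hc hd ⟨k, hk⟩
  obtain ⟨t, ht, htd⟩ := exists_between hd
  have hconst : S t = S (levelMax S u) := by rw [hk _ ⟨hc, hd⟩, hk t ⟨hc.trans ht, htd⟩]
  exact ht.not_ge (hS.le_levelMax (hconst.trans (hS.apply_levelMax_eq_max u)).le)

theorem levelMax_mem_Icc (hS : IsStaircase F S) (hx : 0 ≤ x) (hu : u ∈ Set.Ico (S x) (S y)) :
    levelMax S u ∈ F ∩ Set.Icc x y := by
  have hu0 : 0 ≤ u := (hS.nonneg hx).trans hu.1
  refine ⟨hS.levelMax_mem u, hS.le_levelMax (hu.1.trans (le_max_left u 0)), ?_⟩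
  refine le_of_not_gt fun h => hu.2.not_ge ?_
  exact (hS.mono h.le).trans_eq (hS.apply_levelMax hu0)

theorem tendsto_levelMax_nhdsGT (hS : IsStaircase F S) (hu : 0 ≤ u) :
    Tendsto (levelMax S) (𝓝[>] u) (𝓝[(F ∩ Set.Ici 0) \ {levelMax S u}] (levelMax S u)) := by
  refine tendsto_nhdsWithin_iff.2 ⟨tendsto_order.2 ⟨fun a ha => ?_, fun a ha => ?_⟩, ?_⟩
  · filter_upwards [self_mem_nhdsWithin] with w (hw : u < w)
    exact ha.trans_le (hS.levelMax_mono hw.le)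
  · have hua : u < S a := lt_of_not_ge fun h =>
      ha.not_ge (hS.le_levelMax (h.trans (le_max_left u 0)))
    filter_upwards [Ioo_mem_nhdsGT hua] with w hw
    refine lt_of_not_ge fun h => hw.2.not_ge ?_
    exact (hS.mono h).trans_eq (hS.apply_levelMax (hu.trans hw.1.le))
  · filter_upwards [self_mem_nhdsWithin] with w (hw : u < w)
    refine ⟨⟨hS.levelMax_mem w, hS.levelMax_nonneg w⟩, fun h => hw.ne' ?_⟩
    rw [← hS.apply_levelMax (hu.trans hw.le), Set.mem_singleton_iff.1 h, hS.apply_levelMax hu]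

theorem exists_tendsto_levelMax_nhdsLT (hS : IsStaircase F S) (hu : 0 < u) :
    ∃ a ∈ F, 0 ≤ a ∧ S a = u ∧
      Tendsto (levelMax S) (𝓝[<] u) (𝓝[(F ∩ Set.Ici 0) \ {a}] a) := by
  have hlim := hS.levelMax_mono.tendsto_nhdsLT u
  set a := sSup (levelMax S '' Set.Iio u)
  have hleft : ∀ᶠ w in 𝓝[<] u, S (levelMax S w) = w ∧ w < u := by
    filter_upwards [Ioo_mem_nhdsLT hu] with w hw using ⟨hS.apply_levelMax hw.1.le, hw.2⟩
  have hSa : S a = u := tendsto_nhds_unique ((hS.cont.tendsto a).comp hlim)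
    ((tendsto_id.mono_left nhdsWithin_le_nhds).congr' (hleft.mono fun w hw => hw.1.symm))
  refine ⟨a, hS.change ?_, ge_of_tendsto hlim (Eventually.of_forall hS.levelMax_nonneg), hSa,
    tendsto_nhdsWithin_iff.2 ⟨hlim, ?_⟩⟩
  · rintro c d hc hd ⟨k, hk⟩
    obtain ⟨w, ⟨hSw, hwu⟩, hcd⟩ := (hleft.and (hlim.eventually (Ioo_mem_nhds hc hd))).exists
    exact hwu.ne (by rw [← hSw, hk _ hcd, ← hk a ⟨hc, hd⟩, hSa])
  · filter_upwards [hleft] with w ⟨hSw, hwu⟩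
    exact ⟨⟨hS.levelMax_mem w, hS.levelMax_nonneg w⟩, fun h => hwu.ne (by
      rw [← hSw, Set.mem_singleton_iff.1 h, hSa])⟩

end IsStaircase

/-- The standing assumption on `f : [0, ∞) → ℝ`: it is a function of the staircase function, and
it is `F^α`-differentiable at the points of `F`. -/
structure IsStaircaseDifferentiable (F : Set ℝ) (α l : ℝ) (f : ℝ → ℝ) : Prop where
  factor : ∀ x y, 0 ≤ x → 0 ≤ y → staircase F α l x = staircase F α l y → f x = f y
  diff : ∀ x ∈ F, 0 ≤ x → ∃ d, HasFractalDerivWithinAt F α l (Set.Ici 0) f d x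

namespace IsStaircaseDifferentiable

variable {F : Set ℝ} {α l : ℝ} {f : ℝ → ℝ} {u x : ℝ}

theorem apply_levelMax (hf : IsStaircaseDifferentiable F α l f)
    (hS : IsStaircase F (staircase F α l)) (hx : 0 ≤ x) :
    f (levelMax (staircase F α l) (staircase F α l x)) = f x :=
  hf.factor _ _ (hS.levelMax_nonneg _) hx (hS.apply_levelMax (hS.nonneg hx))

theorem hasDerivWithinAt (hf : IsStaircaseDifferentiable F α l f)
    (hS : IsStaircase F (staircase F α l)) (hu : 0 ≤ u) :
    HasDerivWithinAt (f ∘ levelMax (staircase F α l))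
      (fractalDerivWithin F α l (Set.Ici 0) f (levelMax (staircase F α l) u)) (Set.Ici u) u := by
  obtain ⟨d, hd⟩ := hf.diff _ (hS.levelMax_mem u) (hS.levelMax_nonneg u)
  have hlim := hS.tendsto_levelMax_nhdsGT hu
  have := hlim.neBot
  rw [fractalDerivWithin, if_pos (hS.levelMax_mem u), hd.limUnder_eq,
    ← hasDerivWithinAt_Ioi_iff_Ici, hasDerivWithinAt_iff_tendsto_slope' Set.self_notMem_Ioi]
  refine (hd.comp hlim).congr' ?_
  filter_upwards [self_mem_nhdsWithin] with w (hw : u < w)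
  simp only [Function.comp, slope_def_field, hS.apply_levelMax hu,
    hS.apply_levelMax (hu.trans hw.le)]

theorem tendsto_nhdsWithin (hf : IsStaircaseDifferentiable F α l f)
    (hS : IsStaircase F (staircase F α l)) (hxF : x ∈ F) (hx : 0 ≤ x) :
    Tendsto f (𝓝[(F ∩ Set.Ici 0) \ {x}] x) (𝓝 (f x)) := by
  obtain ⟨d, hd⟩ := hf.diff x hxF hx
  have hincr : Tendsto (fun y => staircase F α l y - staircase F α l x)
      (𝓝[(F ∩ Set.Ici 0) \ {x}] x) (𝓝 0) :=
    tendsto_nhdsWithin_of_tendsto_nhds ((hS.cont.sub continuous_const).tendsto' _ _ (sub_self _))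
  have hlim := (hd.mul hincr).add_const (f x)
  rw [mul_zero, zero_add] at hlim
  refine hlim.congr' ?_
  filter_upwards [self_mem_nhdsWithin] with y hy
  rcases eq_or_ne (staircase F α l y) (staircase F α l x) with h | h
  · rw [h, sub_self, mul_zero, zero_add, hf.factor y x hy.1.2 hx h]
  · rw [div_mul_cancel₀ _ (sub_ne_zero.2 h), sub_add_cancel]

theorem continuous (hf : IsStaircaseDifferentiable F α l f)
    (hS : IsStaircase F (staircase F α l)) : Continuous (f ∘ levelMax (staircase F α l)) := by
  have hright : ∀ u, 0 ≤ u → ContinuousWithinAt (f ∘ levelMax (staircase F α l)) (Set.Ici u) u :=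
    fun u hu => (hf.hasDerivWithinAt hS hu).continuousWithinAt
  have hleft : ∀ u, 0 < u → ContinuousWithinAt (f ∘ levelMax (staircase F α l)) (Set.Iic u) u := by
    intro u hu
    obtain ⟨a, haF, ha, hSa, hlim⟩ := hS.exists_tendsto_levelMax_nhdsLT hu
    have hfa : f (levelMax (staircase F α l) u) = f a := hSa ▸ hf.apply_levelMax hS ha
    rw [← continuousWithinAt_Iio_iff_Iic, ContinuousWithinAt, Function.comp_apply, hfa]
    exact (hf.tendsto_nhdsWithin hS haF ha).comp hlim
  have hon : ContinuousOn (f ∘ levelMax (staircase F α l)) (Set.Ici 0) := by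
    intro u (hu : 0 ≤ u)
    rcases hu.eq_or_lt with rfl | hpos
    · exact hright 0 le_rfl
    · exact (continuousAt_iff_continuous_left_right.2
        ⟨hleft u hpos, hright u hu⟩).continuousWithinAt
  have hmax := hon.comp_continuous (f := fun u : ℝ => max u 0) (by fun_prop) fun u =>
    le_max_right u 0
  simpa only [Function.comp_def, levelMax, max_assoc, max_self] using hmax

end IsStaircaseDifferentiable

section Darboux

open MeasureTheory

theorem bddAbove_image_of_abs_le {h : ℝ → ℝ} {B : ℝ} {A : Set ℝ} (hB : ∀ t ∈ A, |h t| ≤ B) :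
    BddAbove (h '' A) :=
  ⟨B, Set.forall_mem_image.2 fun t ht => (abs_le.1 (hB t ht)).2⟩

theorem bddBelow_image_of_abs_le {h : ℝ → ℝ} {B : ℝ} {A : Set ℝ} (hB : ∀ t ∈ A, |h t| ≤ B) :
    BddBelow (h '' A) :=
  ⟨-B, Set.forall_mem_image.2 fun t ht => (abs_le.1 (hB t ht)).1⟩

/-- The contribution of the interval `[u, v]` to a lower sum of `h` with respect to `S`. -/
noncomputable def lowerPiece (F : Set ℝ) (S h : ℝ → ℝ) (u v : ℝ) : ℝ :=
  sInf (h '' (F ∩ Set.Icc u v)) * (S v - S u)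

/-- The contribution of the interval `[u, v]` to an upper sum of `h` with respect to `S`. -/
noncomputable def upperPiece (F : Set ℝ) (S h : ℝ → ℝ) (u v : ℝ) : ℝ :=
  sSup (h '' (F ∩ Set.Icc u v)) * (S v - S u)

namespace IsStaircase

variable {F : Set ℝ} {S h : ℝ → ℝ} {a b c u v B : ℝ}

theorem apply_eq_of_inter_Icc_eq_empty (hS : IsStaircase F S) (hu : 0 ≤ u) (huv : u ≤ v)
    (hempty : F ∩ Set.Icc u v = ∅) : S u = S v := by
  refine (hS.mono huv).eq_of_not_lt fun hlt => ?_
  exact Set.eq_empty_iff_forall_notMem.1 hempty _ (hS.levelMax_mem_Icc hu ⟨le_rfl, hlt⟩)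

theorem mul_le_lowerPiece (hS : IsStaircase F S) (hu : 0 ≤ u) (huv : u ≤ v)
    (hc : ∀ t ∈ F ∩ Set.Icc u v, c ≤ h t) : c * (S v - S u) ≤ lowerPiece F S h u v := by
  rcases (F ∩ Set.Icc u v).eq_empty_or_nonempty with hempty | hne
  · simp [lowerPiece, hS.apply_eq_of_inter_Icc_eq_empty hu huv hempty]
  · exact mul_le_mul_of_nonneg_right (le_csInf (hne.image h) (Set.forall_mem_image.2 hc))
      (sub_nonneg.2 (hS.mono huv))

theorem upperPiece_le_mul (hS : IsStaircase F S) (hu : 0 ≤ u) (huv : u ≤ v)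
    (hc : ∀ t ∈ F ∩ Set.Icc u v, h t ≤ c) : upperPiece F S h u v ≤ c * (S v - S u) := by
  rcases (F ∩ Set.Icc u v).eq_empty_or_nonempty with hempty | hne
  · simp [upperPiece, hS.apply_eq_of_inter_Icc_eq_empty hu huv hempty]
  · exact mul_le_mul_of_nonneg_right (csSup_le (hne.image h) (Set.forall_mem_image.2 hc))
      (sub_nonneg.2 (hS.mono huv))

theorem upperPiece_sub_lowerPiece_le (hS : IsStaircase F S) (hu : 0 ≤ u) (huv : u ≤ v)
    (hc : ∀ s ∈ F ∩ Set.Icc u v, ∀ t ∈ F ∩ Set.Icc u v, h s - h t ≤ c) :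
    upperPiece F S h u v - lowerPiece F S h u v ≤ c * (S v - S u) := by
  have hupper := hS.upperPiece_le_mul (h := h) (c := sInf (h '' (F ∩ Set.Icc u v)) + c) hu huv
    fun s hs => by
      have := le_csInf (Set.Nonempty.image h ⟨s, hs⟩)
        (Set.forall_mem_image.2 fun t ht => show h s - c ≤ h t by linarith [hc s hs t ht])
      linarith
  rw [lowerPiece]
  linarith

theorem upperPiece_mul_sub_lowerPiece_mul_le (hS : IsStaircase F S) (hu : 0 ≤ u) (huv : u ≤ v)
    {φ : ℝ → ℝ} {E η : ℝ} (hB : ∀ t ∈ F ∩ Set.Icc u v, |h t| ≤ B)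
    (hE : ∀ t ∈ Set.Icc u v, |φ (S t)| ≤ E)
    (hη : ∀ s ∈ Set.Icc u v, ∀ t ∈ Set.Icc u v, |φ (S s) - φ (S t)| ≤ η) :
    upperPiece F S (fun t => φ (S t) * h t) u v - lowerPiece F S (fun t => φ (S t) * h t) u v ≤
      E * (upperPiece F S h u v - lowerPiece F S h u v) + η * B * (S v - S u) := by
  have hosc : ∀ s ∈ F ∩ Set.Icc u v, ∀ t ∈ F ∩ Set.Icc u v,
      h s - h t ≤ sSup (h '' (F ∩ Set.Icc u v)) - sInf (h '' (F ∩ Set.Icc u v)) :=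
    fun s hs t ht => sub_le_sub (le_csSup (bddAbove_image_of_abs_le hB) ⟨s, hs, rfl⟩)
      (csInf_le (bddBelow_image_of_abs_le hB) ⟨t, ht, rfl⟩)
  set osc := sSup (h '' (F ∩ Set.Icc u v)) - sInf (h '' (F ∩ Set.Icc u v)) with hosc_def
  calc upperPiece F S (fun t => φ (S t) * h t) u v - lowerPiece F S (fun t => φ (S t) * h t) u v
    _ ≤ (E * osc + η * B) * (S v - S u) := by
        refine hS.upperPiece_sub_lowerPiece_le hu huv fun s hs t ht => ?_
        have hh : |h s - h t| ≤ osc := abs_sub_le_iff.2 ⟨hosc s hs t ht, hosc t ht s hs⟩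
        calc φ (S s) * h s - φ (S t) * h t
          _ = φ (S s) * (h s - h t) + (φ (S s) - φ (S t)) * h t := by ring
          _ ≤ |φ (S s)| * |h s - h t| + |φ (S s) - φ (S t)| * |h t| := by
              rw [← abs_mul, ← abs_mul]
              exact add_le_add (le_abs_self _) (le_abs_self _)
          _ ≤ E * osc + η * B := by
              have hE0 := (abs_nonneg _).trans (hE s hs.2)
              have hη0 := (abs_nonneg _).trans (hη s hs.2 t ht.2)
              gcongr
              exacts [hE s hs.2, hη s hs.2 t ht.2, hB t ht]
    _ = _ := by
        rw [hosc_def, upperPiece, lowerPiece]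
        ring

theorem cutSubadditiveOn_lowerPiece (hS : IsStaircase F S) (ha : 0 ≤ a)
    (hbdd : BddBelow (h '' (F ∩ Set.Icc a b))) : CutSubadditiveOn (lowerPiece F S h) a b where
  self u := by simp [lowerPiece]
  cut u v w hu huv hvw hw := by
    have hinf : ∀ t ∈ F ∩ Set.Icc u w, sInf (h '' (F ∩ Set.Icc u w)) ≤ h t := fun t ht =>
      csInf_le (hbdd.mono (by gcongr)) ⟨t, ht, rfl⟩
    have hleft := hS.mul_le_lowerPiece (ha.trans hu) huv fun t ht =>
      hinf t ⟨ht.1, ht.2.1, ht.2.2.trans hvw⟩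
    have hright := hS.mul_le_lowerPiece (ha.trans (hu.trans huv)) hvw fun t ht =>
      hinf t ⟨ht.1, huv.trans ht.2.1, ht.2.2⟩
    rw [lowerPiece]
    linarith

theorem lowerPiece_neg (F : Set ℝ) (S h : ℝ → ℝ) (u v : ℝ) :
    lowerPiece F S (fun t => -h t) u v = -upperPiece F S h u v := by
  rw [lowerPiece, upperPiece, ← neg_mul, ← Real.sInf_neg, ← Set.image_neg_eq_neg, Set.image_image]

theorem sum_lowerPiece_neg (F : Set ℝ) (S h : ℝ → ℝ) (P : Subdivision a b) :
    P.sum (lowerPiece F S fun t => -h t) = -P.sum (upperPiece F S h) := by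
  simp only [Subdivision.sum, lowerPiece_neg, Finset.sum_neg_distrib]

theorem lowerPiece_le_integral (hS : IsStaircase F S) (hu : 0 ≤ u) (huv : u ≤ v)
    (hbdd : BddBelow (h '' (F ∩ Set.Icc u v)))
    (hInt : IntervalIntegrable (h ∘ levelMax S) volume (S u) (S v)) :
    lowerPiece F S h u v ≤ ∫ w in S u..S v, h (levelMax S w) := by
  calc lowerPiece F S h u v = ∫ _ in S u..S v, sInf (h '' (F ∩ Set.Icc u v)) := by
        rw [intervalIntegral.integral_const, smul_eq_mul, mul_comm, lowerPiece]
    _ ≤ _ := intervalIntegral.integral_mono_on_of_le_Ioo (hS.mono huv)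
        intervalIntegrable_const hInt fun w hw =>
          csInf_le hbdd ⟨_, hS.levelMax_mem_Icc hu ⟨hw.1.le, hw.2⟩, rfl⟩

theorem sum_lowerPiece_le_integral (hS : IsStaircase F S) (ha : 0 ≤ a)
    (hbdd : BddBelow (h '' (F ∩ Set.Icc a b)))
    (hInt : IntervalIntegrable (h ∘ levelMax S) volume (S a) (S b)) (P : Subdivision a b) :
    P.sum (lowerPiece F S h) ≤ ∫ w in S a..S b, h (levelMax S w) := by
  have hsub : ∀ {s t}, a ≤ s → s ≤ t → t ≤ b →
      IntervalIntegrable (h ∘ levelMax S) volume (S s) (S t) := fun has hst htb =>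
    hInt.mono_set <| by
      rw [Set.uIcc_of_le (hS.mono hst), Set.uIcc_of_le (hS.mono (has.trans (hst.trans htb)))]
      exact Set.Icc_subset_Icc (hS.mono has) (hS.mono htb)
  have hsum := P.sum_sub fun t => ∫ w in S a..S t, h (levelMax S w)
  rw [intervalIntegral.integral_same, sub_zero] at hsum
  rw [← hsum]
  refine P.sum_le_sum fun i hi => ?_
  have hai := P.le_pt hi.le
  have hmono := P.mono i hi
  have hib := P.pt_le (i := i + 1) hi
  have hpiece := intervalIntegral.integral_interval_sub_left (hsub le_rfl (hai.trans hmono) hib)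
    (hsub le_rfl hai (hmono.trans hib))
  simp only [Function.comp_apply] at hpiece
  rw [hpiece]
  exact hS.lowerPiece_le_integral (ha.trans hai) hmono (hbdd.mono (by gcongr))
    (hsub hai hmono hib)

theorem integral_le_sum_upperPiece (hS : IsStaircase F S) (ha : 0 ≤ a)
    (hbdd : BddAbove (h '' (F ∩ Set.Icc a b)))
    (hInt : IntervalIntegrable (h ∘ levelMax S) volume (S a) (S b)) (P : Subdivision a b) :
    ∫ w in S a..S b, h (levelMax S w) ≤ P.sum (upperPiece F S h) := by
  have hneg := hS.sum_lowerPiece_le_integral (h := fun t => -h t) ha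
    (by simpa only [← Set.image_neg_eq_neg, Set.image_image] using hbdd.neg) hInt.neg P
  rw [sum_lowerPiece_neg, intervalIntegral.integral_neg] at hneg
  exact neg_le_neg_iff.1 hneg

theorem intervalIntegrable_comp_levelMax (hS : IsStaircase F S) (ha : 0 ≤ a) (hab : a ≤ b)
    (hh : Measurable (h ∘ levelMax S)) (hB : ∀ t ∈ F ∩ Set.Icc a b, |h t| ≤ B) :
    IntervalIntegrable (h ∘ levelMax S) volume (S a) (S b) := by
  rw [intervalIntegrable_iff_integrableOn_Ioo_of_le (hS.mono hab)]
  refine Measure.integrableOn_of_bounded (M := B) (by simp) hh.aestronglyMeasurable ?_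
  filter_upwards [ae_restrict_mem measurableSet_Ioo] with w hw
  exact hB _ (hS.levelMax_mem_Icc ha ⟨hw.1.le, hw.2⟩)

end IsStaircase

/-- `h` is `F^α`-integrable on `[a, b]` and its integral is `J`. -/
def HasFractalIntegral (F : Set ℝ) (α l : ℝ) (h : ℝ → ℝ) (a b J : ℝ) : Prop :=
  FractalIntegrable F α l h a b ∧ fractalIntegral F α l h a b = J

variable {F : Set ℝ} {α l a b B J : ℝ} {h k φ : ℝ → ℝ}

theorem fractalLowerSum_eq_sum (P : Subdivision a b) :
    fractalLowerSum F α l h P = P.sum (lowerPiece F (staircase F α l) h) := rfl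

theorem fractalUpperSum_eq_sum (P : Subdivision a b) :
    fractalUpperSum F α l h P = P.sum (upperPiece F (staircase F α l) h) := rfl

theorem Subdivision.nonempty (hab : a ≤ b) : Nonempty (Subdivision a b) := ⟨single a b hab⟩

namespace HasFractalIntegral

theorem congr (hh : HasFractalIntegral F α l h a b J) (hk : Set.EqOn k h (F ∩ Set.Icc a b)) :
    HasFractalIntegral F α l k a b J := by
  have himage : ∀ (P : Subdivision a b), ∀ i < P.n, k '' (F ∩ Set.Icc (P.pt i) (P.pt (i + 1))) =
      h '' (F ∩ Set.Icc (P.pt i) (P.pt (i + 1))) := fun P i hi =>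
    (hk.mono (Set.inter_subset_inter_right F
      (Set.Icc_subset_Icc (P.le_pt hi.le) (P.pt_le hi)))).image_eq
  have hlower : ∀ P : Subdivision a b, fractalLowerSum F α l k P = fractalLowerSum F α l h P :=
    fun P => Finset.sum_congr rfl fun i hi => by rw [himage P i (Finset.mem_range.1 hi)]
  have hupper : ∀ P : Subdivision a b, fractalUpperSum F α l k P = fractalUpperSum F α l h P :=
    fun P => Finset.sum_congr rfl fun i hi => by rw [himage P i (Finset.mem_range.1 hi)]
  simpa only [HasFractalIntegral, FractalIntegrable, fractalIntegral, hlower, hupper,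
    hk.image_eq] using hh

/-- The integral of `h` over the levels separates all lower sums from all upper sums, so a small
gap identifies it as the common value. -/
theorem of_exists_upperSum_sub_lowerSum_le (hS : IsStaircase F (staircase F α l)) (ha : 0 ≤ a)
    (hab : a ≤ b) (hh : Measurable (h ∘ levelMax (staircase F α l)))
    (hB : ∀ t ∈ F ∩ Set.Icc a b, |h t| ≤ B)
    (hgap : ∀ ε > 0, ∃ P : Subdivision a b,
      fractalUpperSum F α l h P - fractalLowerSum F α l h P ≤ ε) :
    HasFractalIntegral F α l h a b
      (∫ u in staircase F α l a..staircase F α l b, h (levelMax (staircase F α l) u)) := by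
  have := Subdivision.nonempty hab
  have hInt := hS.intervalIntegrable_comp_levelMax ha hab hh hB
  have hlower := hS.sum_lowerPiece_le_integral ha (bddBelow_image_of_abs_le hB) hInt
  have hupper := hS.integral_le_sum_upperPiece ha (bddAbove_image_of_abs_le hB) hInt
  set I := ∫ u in staircase F α l a..staircase F α l b, h (levelMax (staircase F α l) u)
  simp only [← fractalLowerSum_eq_sum] at hlower
  simp only [← fractalUpperSum_eq_sum] at hupper
  have hsup : ⨆ P : Subdivision a b, fractalLowerSum F α l h P = I := by
    refine ciSup_eq_of_forall_le_of_forall_lt_exists_gt hlower fun c hc => ?_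
    obtain ⟨P, hP⟩ := hgap ((I - c) / 2) (by linarith)
    exact ⟨P, by linarith [hupper P]⟩
  have hinf : ⨅ P : Subdivision a b, fractalUpperSum F α l h P = I := by
    refine ciInf_eq_of_forall_ge_of_forall_gt_exists_lt hupper fun c hc => ?_
    obtain ⟨P, hP⟩ := hgap ((c - I) / 2) (by linarith)
    exact ⟨P, by linarith [hlower P]⟩
  exact ⟨⟨bddAbove_image_of_abs_le hB, bddBelow_image_of_abs_le hB, hsup.trans hinf.symm⟩, hsup⟩

end HasFractalIntegral

namespace FractalIntegrable

theorem exists_abs_le (hh : FractalIntegrable F α l h a b) :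
    ∃ B, ∀ t ∈ F ∩ Set.Icc a b, |h t| ≤ B := by
  obtain ⟨M, hM⟩ := hh.1
  obtain ⟨m, hm⟩ := hh.2.1
  refine ⟨max |m| |M|, fun t ht => ?_⟩
  exact abs_le_max_abs_abs (hm ⟨t, ht, rfl⟩) (hM ⟨t, ht, rfl⟩)

theorem exists_upperSum_sub_lowerSum_le (hh : FractalIntegrable F α l h a b)
    (hS : IsStaircase F (staircase F α l)) (ha : 0 ≤ a) (hab : a ≤ b) {ε δ : ℝ} (hε : 0 < ε)
    (hδ : 0 < δ) :
    ∃ R : Subdivision a b, R.MeshLE δ ∧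
      fractalUpperSum F α l h R - fractalLowerSum F α l h R ≤ ε := by
  have := Subdivision.nonempty hab
  obtain ⟨P, hP⟩ := exists_lt_of_lt_ciSup (sub_lt_self (⨆ P : Subdivision a b,
    fractalLowerSum F α l h P) (half_pos hε))
  obtain ⟨Q, hQ⟩ := exists_lt_of_ciInf_lt (lt_add_of_pos_right (⨅ P : Subdivision a b,
    fractalUpperSum F α l h P) (half_pos hε))
  obtain ⟨M, hM⟩ := Subdivision.exists_meshLE hab hδ
  obtain ⟨R₀, -, hR₀⟩ := P.exists_common_refinement Q
  obtain ⟨R, hmesh, hR⟩ := R₀.exists_common_refinement M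
  have hlower := hS.cutSubadditiveOn_lowerPiece ha hh.2.1
  have hupper := hS.cutSubadditiveOn_lowerPiece (h := fun t => -h t) ha
    (by simpa only [← Set.image_neg_eq_neg, Set.image_image] using hh.1.neg)
  have hPR := (hR₀ _ hlower).1.trans (hR _ hlower).1
  have hQR := (hR₀ _ hupper).2.trans (hR _ hupper).1
  rw [← fractalLowerSum_eq_sum, ← fractalLowerSum_eq_sum] at hPR
  rw [IsStaircase.sum_lowerPiece_neg, IsStaircase.sum_lowerPiece_neg, neg_le_neg_iff,
    ← fractalUpperSum_eq_sum, ← fractalUpperSum_eq_sum] at hQR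
  exact ⟨R, hmesh δ hM, by linarith [hh.2.2]⟩

theorem exists_upperSum_mul_sub_lowerSum_mul_le (hh : FractalIntegrable F α l h a b)
    (hS : IsStaircase F (staircase F α l)) (ha : 0 ≤ a) (hab : a ≤ b) (hφ : Continuous φ)
    {E : ℝ} (hB : ∀ t ∈ F ∩ Set.Icc a b, |h t| ≤ B)
    (hE : ∀ t ∈ Set.Icc a b, |φ (staircase F α l t)| ≤ E) {η : ℝ} (hη : 0 < η) :
    ∃ R : Subdivision a b,
      fractalUpperSum F α l (fun t => φ (staircase F α l t) * h t) R -
        fractalLowerSum F α l (fun t => φ (staircase F α l t) * h t) R ≤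
      E * η + η * B * (staircase F α l b - staircase F α l a) := by
  set S := staircase F α l with hSdef
  obtain ⟨δ, hδ, hφδ⟩ := Metric.uniformContinuousOn_iff_le.1
    (isCompact_Icc.uniformContinuousOn_of_continuous (hφ.comp hS.cont).continuousOn) η hη
  obtain ⟨R, hmesh, hR⟩ := hh.exists_upperSum_sub_lowerSum_le hS ha hab hη hδ
  have hE0 : 0 ≤ E := (abs_nonneg _).trans (hE a ⟨le_rfl, hab⟩)
  refine ⟨R, ?_⟩
  calc fractalUpperSum F α l (fun t => φ (S t) * h t) R -
        fractalLowerSum F α l (fun t => φ (S t) * h t) R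
    _ = R.sum fun u v => upperPiece F S (fun t => φ (S t) * h t) u v -
          lowerPiece F S (fun t => φ (S t) * h t) u v := Finset.sum_sub_distrib .. |>.symm
    _ ≤ R.sum fun u v => E * (upperPiece F S h u v - lowerPiece F S h u v) +
          η * B * (S v - S u) := by
        refine R.sum_le_sum fun i hi => ?_
        have hsub : Set.Icc (R.pt i) (R.pt (i + 1)) ⊆ Set.Icc a b :=
          Set.Icc_subset_Icc (R.le_pt hi.le) (R.pt_le hi)
        exact hS.upperPiece_mul_sub_lowerPiece_mul_le (ha.trans (R.le_pt hi.le)) (R.mono i hi)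
          (fun t ht => hB t ⟨ht.1, hsub ht.2⟩) (fun t ht => hE t (hsub ht))
          fun s hs t ht => hφδ s (hsub hs) t (hsub ht)
            ((Real.dist_le_of_mem_Icc hs ht).trans (hmesh i hi))
    _ = E * (fractalUpperSum F α l h R - fractalLowerSum F α l h R) + η * B * (S b - S a) := by
        rw [← R.sum_sub S, fractalUpperSum_eq_sum, fractalLowerSum_eq_sum]
        simp only [Subdivision.sum, Finset.sum_add_distrib, Finset.sum_sub_distrib,
          ← Finset.mul_sum, hSdef]
    _ ≤ E * η + η * B * (S b - S a) := by gcongr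

theorem hasFractalIntegral_mul (hh : FractalIntegrable F α l h a b)
    (hS : IsStaircase F (staircase F α l)) (ha : 0 ≤ a) (hab : a ≤ b)
    (hmeas : Measurable (h ∘ levelMax (staircase F α l))) (hφ : Continuous φ) :
    HasFractalIntegral F α l (fun t => φ (staircase F α l t) * h t) a b
      (∫ u in staircase F α l a..staircase F α l b, φ u * h (levelMax (staircase F α l) u)) := by
  obtain ⟨B, hB⟩ := hh.exists_abs_le
  obtain ⟨E, hE⟩ := isCompact_Icc.exists_bound_of_continuousOn (s := Set.Icc a b)
    (hφ.comp hS.cont).continuousOn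
  have hlevel : ∀ u, φ (staircase F α l (levelMax (staircase F α l) u)) = φ (max u 0) := fun u => by
    rw [hS.apply_levelMax_eq_max]
  have hmeas' : Measurable
      ((fun t => φ (staircase F α l t) * h t) ∘ levelMax (staircase F α l)) := by
    simp only [Function.comp_def, hlevel]
    exact (hφ.comp (by fun_prop)).measurable.mul hmeas
  have hprod := HasFractalIntegral.of_exists_upperSum_sub_lowerSum_le hS ha hab hmeas' (B := E * B)
    (fun t ht => by
      rw [abs_mul]
      exact mul_le_mul (hE t ht.2) (hB t ht) (abs_nonneg _) ((norm_nonneg _).trans (hE t ht.2)))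
    fun ε hε => ?_
  · rwa [intervalIntegral.integral_congr fun u hu => ?_] at hprod
    have hu : 0 ≤ u := (hS.nonneg ha).trans (Set.uIcc_of_le (hS.mono hab) ▸ hu).1
    rw [hlevel, max_eq_left hu]
  · set K := E + B * (staircase F α l b - staircase F α l a)
    obtain ⟨R, hR⟩ := hh.exists_upperSum_mul_sub_lowerSum_mul_le hS ha hab hφ hB hE
      (η := ε / (|K| + 1)) (by positivity)
    refine ⟨R, hR.trans ?_⟩
    calc E * (ε / (|K| + 1)) + ε / (|K| + 1) * B * (staircase F α l b - staircase F α l a)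
      _ = ε / (|K| + 1) * K := by ring
      _ ≤ ε / (|K| + 1) * (|K| + 1) := by
          gcongr
          linarith [le_abs_self K]
      _ = ε := by field_simp

end FractalIntegrable

theorem fractalIntegrable_one (hS : IsStaircase F (staircase F α l)) (ha : 0 ≤ a) (hab : a ≤ b) :
    FractalIntegrable F α l (fun _ => 1) a b := by
  refine (HasFractalIntegral.of_exists_upperSum_sub_lowerSum_le hS ha hab measurable_const
    (B := 1) (by simp) fun ε hε => ⟨Subdivision.single a b hab, ?_⟩).1
  rw [fractalUpperSum_eq_sum, fractalLowerSum_eq_sum, Subdivision.sum_single,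
    Subdivision.sum_single]
  refine (hS.upperPiece_sub_lowerPiece_le (c := 0) ha hab (by simp)).trans ?_
  simpa using hε.le

theorem hasFractalIntegral_comp_staircase (hS : IsStaircase F (staircase F α l)) (ha : 0 ≤ a)
    (hab : a ≤ b) (hφ : Continuous φ) :
    HasFractalIntegral F α l (fun t => φ (staircase F α l t)) a b
      (∫ u in staircase F α l a..staircase F α l b, φ u) := by
  simpa using (fractalIntegrable_one hS ha hab).hasFractalIntegral_mul hS ha hab
    measurable_const hφ

end Darboux

section ExponentialKernels

open MeasureTheory Real

theorem tendsto_exp_neg_mul_atTop {p : ℝ} (hp : 0 < p) :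
    Tendsto (fun U => exp (-(p * U))) atTop (𝓝 0) :=
  tendsto_exp_neg_atTop_nhds_zero.comp (tendsto_id.const_mul_atTop hp)

theorem hasDerivAt_exp_mul (c u : ℝ) : HasDerivAt (fun w => exp (c * w)) (c * exp (c * u)) u := by
  simpa [mul_comm] using ((hasDerivAt_id u).const_mul c).exp

theorem hasDerivAt_integral_zero {k : ℝ → ℝ} (hk : Continuous k) (u : ℝ) :
    HasDerivAt (fun U => ∫ w in (0 : ℝ)..U, k w) (k u) u :=
  (hk.integral_hasStrictDerivAt 0 u).hasDerivAt

theorem continuous_integral_zero {k : ℝ → ℝ} (hk : Continuous k) :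
    Continuous fun U => ∫ w in (0 : ℝ)..U, k w :=
  intervalIntegral.continuous_primitive hk.intervalIntegrable 0

theorem exists_abs_le_of_tendsto_atTop {A : ℝ → ℝ} {L : ℝ} (hA : Continuous A)
    (hL : Tendsto A atTop (𝓝 L)) : ∃ B, ∀ u, 0 ≤ u → |A u| ≤ B := by
  obtain ⟨M, hM⟩ := eventually_atTop.1 (hL.abs.eventually_le_const (lt_add_one |L|))
  obtain ⟨B, hB⟩ := isCompact_Icc.exists_bound_of_continuousOn (s := Set.Icc 0 M) hA.continuousOn
  refine ⟨max B (|L| + 1), fun u hu => ?_⟩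
  rcases le_total u M with h | h
  · exact (hB u ⟨hu, h⟩).trans (le_max_left _ _)
  · exact (hM u h).trans (le_max_right _ _)

theorem tendsto_exp_neg_mul_integral_exp_mul {A : ℝ → ℝ} {p L : ℝ} (hp : 0 < p)
    (hA : Continuous A) (hL : Tendsto A atTop (𝓝 L)) :
    Tendsto (fun U => exp (-(p * U)) * ∫ w in (0 : ℝ)..U, exp (p * w) * A w) atTop
      (𝓝 (L / p)) := by
  obtain ⟨B, hB⟩ := exists_abs_le_of_tendsto_atTop hA hL
  have hlim : Tendsto (fun U => ∫ v in Set.Ioi (0 : ℝ),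
      (Set.Iic U).indicator (fun v => exp (-p * v) * A (U - v)) v) atTop
      (𝓝 (∫ v in Set.Ioi (0 : ℝ), exp (-p * v) * L)) := by
    refine tendsto_integral_filter_of_dominated_convergence (fun v => exp (-p * v) * B)
      (Eventually.of_forall fun U => ?_) (Eventually.of_forall fun U => ?_)
      ((integrableOn_exp_mul_Ioi (neg_neg_of_pos hp) 0).mul_const B) (ae_of_all _ fun v => ?_)
    · exact ((by fun_prop : Continuous fun v => exp (-p * v) * A (U - v)).measurable.indicator
        measurableSet_Iic).aestronglyMeasurable
    · refine ae_of_all _ fun v => ?_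
      have hB0 : 0 ≤ B := (abs_nonneg _).trans (hB 0 le_rfl)
      rw [norm_indicator_eq_indicator_norm]
      refine Set.indicator_apply_le' (fun hv => ?_) fun _ => by positivity
      rw [norm_mul, Real.norm_of_nonneg (exp_pos _).le]
      exact mul_le_mul_of_nonneg_left (hB _ (sub_nonneg.2 hv)) (exp_pos _).le
    · refine ((hL.comp (tendsto_atTop_add_const_right _ (-v) tendsto_id)).const_mul _).congr' ?_
      filter_upwards [eventually_ge_atTop v] with U hU
      rw [Set.indicator_of_mem (show v ∈ Set.Iic U from hU), Function.comp_apply, id,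
        ← sub_eq_add_neg]
  rw [integral_mul_const, integral_exp_mul_Ioi (neg_neg_of_pos hp), mul_zero, exp_zero,
    neg_div_neg_eq, one_div_mul_eq_div] at hlim
  refine hlim.congr' ?_
  filter_upwards [eventually_ge_atTop 0] with U hU
  rw [setIntegral_indicator measurableSet_Iic, Set.Ioi_inter_Iic,
    ← intervalIntegral.integral_of_le hU, ← intervalIntegral.integral_const_mul]
  have hsubst := intervalIntegral.integral_comp_sub_left (a := 0) (b := U)
    (fun w => exp (-(p * U)) * (exp (p * w) * A w)) U
  rw [sub_self, sub_zero] at hsubst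
  rw [← hsubst]
  refine intervalIntegral.integral_congr fun v _ => ?_
  simp only [← mul_assoc, ← exp_add]
  ring_nf

/-- The continuous form of Kronecker's lemma, for an exponential weight. -/
theorem tendsto_exp_neg_mul_integral_exp_mul_zero {a : ℝ → ℝ} {p L : ℝ} (hp : 0 < p)
    (ha : Continuous a) (hL : Tendsto (fun U => ∫ w in (0 : ℝ)..U, a w) atTop (𝓝 L)) :
    Tendsto (fun U => exp (-(p * U)) * ∫ w in (0 : ℝ)..U, exp (p * w) * a w) atTop (𝓝 0) := by
  have hA : Continuous fun U => ∫ w in (0 : ℝ)..U, a w := continuous_integral_zero ha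
  have hparts : ∀ U, ∫ w in (0 : ℝ)..U, exp (p * w) * a w = exp (p * U) * (∫ w in (0 : ℝ)..U, a w) -
      p * ∫ w in (0 : ℝ)..U, exp (p * w) * ∫ x in (0 : ℝ)..w, a x := fun U => by
    rw [intervalIntegral.integral_mul_deriv_eq_deriv_mul (fun w _ => hasDerivAt_exp_mul p w)
      (fun w _ => hasDerivAt_integral_zero ha w)
      ((by fun_prop : Continuous _).intervalIntegrable 0 U) (ha.intervalIntegrable 0 U)]
    simp [mul_assoc]
  have hlim := hL.sub ((tendsto_exp_neg_mul_integral_exp_mul hp hA hL).const_mul p)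
  rw [mul_div_cancel₀ _ hp.ne', sub_self] at hlim
  refine hlim.congr fun U => ?_
  rw [hparts, mul_sub, ← mul_assoc (exp _) (exp _), ← exp_add, neg_add_cancel, exp_zero, one_mul,
    mul_left_comm]

/-- The exponential smoothing of `g` at rate `κ`: the solution of `q' = κ (g - q)`, `q 0 = g 0`.
Up to a constant factor, the wsk-derivative of `g` is `g - expSmoothing κ g`. -/
noncomputable def expSmoothing (κ : ℝ) (g : ℝ → ℝ) (u : ℝ) : ℝ :=
  exp (-(κ * u)) * (g 0 + κ * ∫ w in (0 : ℝ)..u, exp (κ * w) * g w)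

variable {g g' : ℝ → ℝ} {κ s L U : ℝ}

theorem expSmoothing_zero (κ : ℝ) (g : ℝ → ℝ) : expSmoothing κ g 0 = g 0 := by
  simp [expSmoothing]

theorem hasDerivAt_expSmoothing (κ : ℝ) (hg : Continuous g) (u : ℝ) :
    HasDerivAt (expSmoothing κ g) (κ * (g u - expSmoothing κ g u)) u := by
  have hexp : HasDerivAt (fun u => exp (-(κ * u))) (-κ * exp (-(κ * u))) u := by
    simpa only [neg_mul] using hasDerivAt_exp_mul (-κ) u
  refine (hexp.mul (((hasDerivAt_integral_zero (k := fun w => exp (κ * w) * g w) (by fun_prop)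
    u).const_mul κ).const_add (g 0))).congr_deriv ?_
  have hinv : exp (-(κ * u)) * exp (κ * u) = 1 := by rw [← exp_add, neg_add_cancel, exp_zero]
  rw [expSmoothing]
  linear_combination κ * g u * hinv

@[fun_prop]
theorem continuous_expSmoothing (κ : ℝ) (hg : Continuous g) : Continuous (expSmoothing κ g) :=
  continuous_iff_continuousAt.2 fun u => (hasDerivAt_expSmoothing κ hg u).continuousAt

theorem integral_exp_mul_rightDeriv (κ : ℝ) (hg : Continuous g) (hU : 0 ≤ U)
    (hg' : ∀ u, 0 ≤ u → HasDerivWithinAt g (g' u) (Set.Ici u) u)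
    (hInt : IntervalIntegrable g' volume 0 U) :
    ∫ u in (0 : ℝ)..U, exp (-(κ * (U - u))) * g' u = g U - expSmoothing κ g U := by
  have hderiv : ∀ u ∈ Set.Ioo 0 U, HasDerivWithinAt
      (fun u => exp (κ * (u - U)) * (g u - expSmoothing κ g u))
      (exp (-(κ * (U - u))) * g' u) (Set.Ioi u) u := fun u hu => by
    have hexp : HasDerivAt (fun u => exp (κ * (u - U))) (exp (κ * (u - U)) * κ) u := by
      simpa using (((hasDerivAt_id u).sub_const U).const_mul κ).exp
    refine ((hexp.hasDerivWithinAt.mul ((hg' u hu.1.le).sub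
      (hasDerivAt_expSmoothing κ hg u).hasDerivWithinAt)).mono Set.Ioi_subset_Ici_self).congr_deriv
      ?_
    rw [show -(κ * (U - u)) = κ * (u - U) by ring, Pi.sub_apply]
    ring
  rw [intervalIntegral.integral_eq_sub_of_hasDeriv_right_of_le hU (by fun_prop) hderiv
    (hInt.continuousOn_mul (by fun_prop))]
  simp [expSmoothing_zero]

theorem mul_integral_exp_mul_expSmoothing (s κ : ℝ) (hg : Continuous g) (U : ℝ) :
    (s + κ) * ∫ u in (0 : ℝ)..U, exp (-(s * u)) * expSmoothing κ g u =
      κ * (∫ u in (0 : ℝ)..U, exp (-(s * u)) * g u) + g 0 -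
        exp (-(s * U)) * expSmoothing κ g U := by
  have hderiv : ∀ u, HasDerivAt (fun u => -(exp (-(s * u)) * expSmoothing κ g u))
      ((s + κ) * (exp (-(s * u)) * expSmoothing κ g u) - κ * (exp (-(s * u)) * g u)) u := by
    intro u
    have hexp : HasDerivAt (fun u => exp (-(s * u))) (-s * exp (-(s * u))) u := by
      simpa only [neg_mul] using hasDerivAt_exp_mul (-s) u
    refine (hexp.mul (hasDerivAt_expSmoothing κ hg u)).neg.congr_deriv ?_
    ring
  have hFTC := intervalIntegral.integral_eq_sub_of_hasDerivAt (a := 0) (b := U)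
    (fun u _ => hderiv u) ((by fun_prop : Continuous _).intervalIntegrable 0 U)
  rw [intervalIntegral.integral_sub ((by fun_prop : Continuous _).intervalIntegrable 0 U)
    ((by fun_prop : Continuous _).intervalIntegrable 0 U), intervalIntegral.integral_const_mul,
    intervalIntegral.integral_const_mul, expSmoothing_zero] at hFTC
  simp only [mul_zero, neg_zero, exp_zero, one_mul] at hFTC
  linear_combination hFTC

theorem tendsto_exp_mul_expSmoothing (hp : 0 < s + κ) (hg : Continuous g)
    (hL : Tendsto (fun U => ∫ u in (0 : ℝ)..U, exp (-(s * u)) * g u) atTop (𝓝 L)) :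
    Tendsto (fun U => exp (-(s * U)) * expSmoothing κ g U) atTop (𝓝 0) := by
  have hlim := ((tendsto_exp_neg_mul_atTop hp).mul_const (g 0)).add
    ((tendsto_exp_neg_mul_integral_exp_mul_zero hp (by fun_prop) hL).const_mul κ)
  rw [zero_mul, mul_zero, add_zero] at hlim
  have hexp : ∀ u, exp ((s + κ) * u) * (exp (-(s * u)) * g u) = exp (κ * u) * g u := fun u => by
    rw [← mul_assoc, ← exp_add]
    ring_nf
  refine hlim.congr fun U => ?_
  simp only [hexp, expSmoothing]
  rw [show -((s + κ) * U) = -(s * U) + -(κ * U) by ring, exp_add]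
  ring

theorem tendsto_integral_exp_mul_sub_expSmoothing (hp : 0 < s + κ) (hg : Continuous g)
    (hL : Tendsto (fun U => ∫ u in (0 : ℝ)..U, exp (-(s * u)) * g u) atTop (𝓝 L)) :
    Tendsto (fun U => ∫ u in (0 : ℝ)..U, exp (-(s * u)) * (g u - expSmoothing κ g u)) atTop
      (𝓝 ((s * L - g 0) / (s + κ))) := by
  have hlim := ((hL.const_mul s).sub_const (g 0)).add (tendsto_exp_mul_expSmoothing hp hg hL)
  rw [add_zero] at hlim
  refine (hlim.div_const (s + κ)).congr fun U => ?_
  simp only [mul_sub]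
  rw [intervalIntegral.integral_sub ((by fun_prop : Continuous _).intervalIntegrable 0 U)
    ((by fun_prop : Continuous _).intervalIntegrable 0 U), div_eq_iff hp.ne']
  linear_combination mul_integral_exp_mul_expSmoothing s κ hg U

end ExponentialKernels

section Transform

open MeasureTheory

variable {F : Set ℝ} {α l γ s t v L : ℝ} {f g h : ℝ → ℝ}

namespace IsStaircaseDifferentiable

theorem measurable_deriv_comp_levelMax (hf : IsStaircaseDifferentiable F α l f)
    (hS : IsStaircase F (staircase F α l)) :
    Measurable (fractalDerivWithin F α l (Set.Ici 0) f ∘ levelMax (staircase F α l)) := by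
  have hderiv : fractalDerivWithin F α l (Set.Ici 0) f ∘ levelMax (staircase F α l) = fun u =>
      derivWithin (f ∘ levelMax (staircase F α l)) (Set.Ici (max u 0)) (max u 0) := by
    funext u
    rw [(hf.hasDerivWithinAt hS (le_max_right u 0)).derivWithin (uniqueDiffWithinAt_Ici _)]
    simp only [Function.comp_apply, levelMax, max_assoc, max_self]
  rw [hderiv]
  exact (measurable_derivWithin_Ici (f ∘ levelMax (staircase F α l))).comp
    (by fun_prop : Measurable fun u : ℝ => max u 0)

theorem hasFractalIntegral_wskIntegrand (hf : IsStaircaseDifferentiable F α l f)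
    (hS : IsStaircase F (staircase F α l)) (ht : 0 ≤ t)
    (hfI : FractalIntegrable F α l (fractalDerivWithin F α l (Set.Ici 0) f) 0 t) :
    HasFractalIntegral F α l (wskIntegrand F α l γ 0 f t) 0 t
      (f t - expSmoothing (γ / (1 - γ)) (f ∘ levelMax (staircase F α l)) (staircase F α l t)) := by
  have hmeas := hf.measurable_deriv_comp_levelMax hS
  obtain ⟨B, hB⟩ := hfI.exists_abs_le
  have hInt := hS.intervalIntegrable_comp_levelMax le_rfl ht hmeas hB
  rw [hS.zero] at hInt
  have hparts := integral_exp_mul_rightDeriv (γ / (1 - γ)) (hf.continuous hS) (hS.nonneg ht)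
    (fun u hu => hf.hasDerivWithinAt hS hu) hInt
  rw [Function.comp_apply, hf.apply_levelMax hS ht] at hparts
  have hmul := hfI.hasFractalIntegral_mul hS le_rfl ht hmeas
    (φ := fun u => Real.exp (-(γ / (1 - γ) * (staircase F α l t - u)))) (by fun_prop)
  rw [hS.zero, hparts] at hmul
  simp only [div_mul_eq_mul_div] at hmul
  exact hmul

end IsStaircaseDifferentiable

/-- The common form of the two transforms: `∫_0^∞ e^{-s S(t)} h(t) d_F^α t` exists and equals
`L`. The Laplace transform at `v` is the case `s = S v`, and the Sumudu transform is, up to the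
factor `1 / S v`, the case `s = 1 / S v`. -/
def HasExpTransform (F : Set ℝ) (α l : ℝ) (h : ℝ → ℝ) (s L : ℝ) : Prop :=
  (∀ T, 0 ≤ T →
    FractalIntegrable F α l (fun t => Real.exp (-(s * staircase F α l t)) * h t) 0 T) ∧
  Tendsto (fun T => fractalIntegral F α l
    (fun t => Real.exp (-(s * staircase F α l t)) * h t) 0 T) atTop (𝓝 L)

theorem hasFractalLaplace_iff :
    HasFractalLaplace F α l h v L ↔ HasExpTransform F α l h (staircase F α l v) L := Iff.rfl

theorem hasFractalSumudu_iff (hv : staircase F α l v ≠ 0) :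
    HasFractalSumudu F α l h v L ↔
      HasExpTransform F α l h (1 / staircase F α l v) (staircase F α l v * L) := by
  simp only [HasFractalSumudu, HasExpTransform, one_div_mul_eq_div, hv, ne_eq, not_false_eq_true,
    true_and]
  refine and_congr_right fun _ => ⟨fun hlim => ?_, fun hlim => ?_⟩
  · simpa only [mul_div_cancel₀ _ hv] using hlim.const_mul (staircase F α l v)
  · simpa only [mul_div_cancel_left₀ _ hv] using hlim.div_const (staircase F α l v)

theorem hasExpTransform_iff (hS : IsStaircase F (staircase F α l)) (hg : Continuous g)
    (hgh : ∀ t, 0 ≤ t → h t = g (staircase F α l t)) :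
    HasExpTransform F α l h s L ↔
      Tendsto (fun U => ∫ u in (0 : ℝ)..U, Real.exp (-(s * u)) * g u) atTop (𝓝 L) := by
  have hInt : ∀ T, 0 ≤ T → HasFractalIntegral F α l
      (fun t => Real.exp (-(s * staircase F α l t)) * h t) 0 T
      (∫ u in (0 : ℝ)..staircase F α l T, Real.exp (-(s * u)) * g u) := fun T hT => by
    have hcomp := hasFractalIntegral_comp_staircase hS le_rfl hT
      (φ := fun u => Real.exp (-(s * u)) * g u) (by fun_prop)
    rw [hS.zero] at hcomp
    exact hcomp.congr fun t ht => by simp only [hgh t ht.2.1]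
  refine ⟨fun hL => (hL.2.comp hS.tendsto_levelMax_atTop).congr' ?_, fun hL =>
    ⟨fun T hT => (hInt T hT).1, (hL.comp hS.top).congr' ?_⟩⟩
  · filter_upwards [eventually_ge_atTop 0] with U hU
    rw [Function.comp_apply, (hInt _ (hS.levelMax_nonneg U)).2, hS.apply_levelMax hU]
  · filter_upwards [eventually_ge_atTop 0] with T hT using (hInt T hT).2.symm

theorem hasExpTransform_wskDeriv (hL : HasExpTransform F α l f s L)
    (hf : IsStaircaseDifferentiable F α l f) (hS : IsStaircase F (staircase F α l)) (N : ℝ → ℝ)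
    (hfI : ∀ T, 0 ≤ T →
      FractalIntegrable F α l (fractalDerivWithin F α l (Set.Ici 0) f) 0 T)
    (hs : 0 < s + γ / (1 - γ)) :
    HasExpTransform F α l (wskDeriv F α l N γ 0 f) s
      (N γ / (1 - γ) * ((s * L - f 0) / (s + γ / (1 - γ)))) := by
  set g := f ∘ levelMax (staircase F α l)
  have hg : Continuous g := hf.continuous hS
  have hfg : ∀ t, 0 ≤ t → f t = g (staircase F α l t) := fun t ht => (hf.apply_levelMax hS ht).symm
  have hg0 : g 0 = f 0 := by rw [hfg 0 le_rfl, hS.zero]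
  have hlim := (tendsto_integral_exp_mul_sub_expSmoothing hs hg
    ((hasExpTransform_iff hS hg hfg).1 hL)).const_mul (N γ / (1 - γ))
  have hwsk : ∀ t, 0 ≤ t → wskDeriv F α l N γ 0 f t = N γ / (1 - γ) *
      (g (staircase F α l t) - expSmoothing (γ / (1 - γ)) g (staircase F α l t)) := fun t ht => by
    rw [wskDeriv, (hf.hasFractalIntegral_wskIntegrand hS ht (hfI t ht)).2, ← hfg t ht]
  rw [hasExpTransform_iff hS (g := fun u => N γ / (1 - γ) * (g u - expSmoothing (γ / (1 - γ)) g u))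
    (by fun_prop) hwsk, ← hg0]
  simpa only [mul_left_comm, intervalIntegral.integral_const_mul] using hlim

end Transform

theorem theorem3p4_general (F : Set ℝ) (α l : ℝ) (hα : 0 < α)
    (hfin : ∀ x y : ℝ, x ≤ y → fractalMass F α x y ≠ ⊤)
    (hchange : setOfChange (staircase F α l) ⊆ F)
    (hS0 : staircase F α l 0 = 0)
    (hSinf : Tendsto (staircase F α l) atTop atTop)
    (N : ℝ → ℝ) (γ : ℝ) (_hγ : γ ≠ 1) (f : ℝ → ℝ)
    (hfS : ∀ x y : ℝ, 0 ≤ x → 0 ≤ y → staircase F α l x = staircase F α l y → f x = f y)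
    (hfD : ∀ x ∈ F, 0 ≤ x → ∃ d, HasFractalDerivWithinAt F α l (Set.Ici 0) f d x)
    (hfI : ∀ T, 0 ≤ T →
      FractalIntegrable F α l (fractalDerivWithin F α l (Set.Ici 0) f) 0 T) :
    (∀ t, 0 ≤ t → FractalIntegrable F α l (wskIntegrand F α l γ 0 f t) 0 t) ∧
    (∀ v Lf : ℝ, 0 < staircase F α l v + γ / (1 - γ) → HasFractalLaplace F α l f v Lf →
      HasFractalLaplace F α l (wskDeriv F α l N γ 0 f) v
        (N γ / (1 - γ) *
          ((staircase F α l v * Lf - f 0) / (staircase F α l v + γ / (1 - γ))))) ∧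
    (∀ v Sf : ℝ, 0 < 1 / staircase F α l v + γ / (1 - γ) → HasFractalSumudu F α l f v Sf →
      HasFractalSumudu F α l (wskDeriv F α l N γ 0 f) v
        (N γ / (1 - γ) *
          ((Sf - f 0) / (1 + γ / (1 - γ) * staircase F α l v)))) := by
  have hS : IsStaircase F (staircase F α l) :=
    ⟨staircase_monotone hα hfin, staircase_continuous hα hfin, hchange, hS0, hSinf⟩
  have hf : IsStaircaseDifferentiable F α l f := ⟨hfS, hfD⟩
  refine ⟨fun t ht => (hf.hasFractalIntegral_wskIntegrand hS ht (hfI t ht)).1, ?_, ?_⟩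
  · intro v Lf hv hL
    exact hasExpTransform_wskDeriv (hasFractalLaplace_iff.1 hL) hf hS N hfI hv
  · intro v Sf hv hL
    have hv0 := hL.1
    rw [hasFractalSumudu_iff hv0] at hL ⊢
    convert hasExpTransform_wskDeriv hL hf hS N hfI hv using 1
    have hfactor : 1 + γ / (1 - γ) * staircase F α l v =
        staircase F α l v * (1 / staircase F α l v + γ / (1 - γ)) := by
      rw [mul_add, mul_one_div_cancel hv0, mul_comm]
    rw [hfactor, ← mul_assoc (1 / _), one_div_mul_cancel hv0, one_mul, mul_left_comm,
      ← mul_div_assoc, mul_div_mul_left _ _ hv0]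

theorem theorem3p4 (F : Set ℝ) (α l : ℝ) (hα0 : 0 < α) (hα1 : α ≤ 1)
    (hF : IsAlphaPerfect F α l)
    (hS0 : staircase F α l 0 = 0)
    (hSinf : Tendsto (staircase F α l) atTop atTop)
    (N : ℝ → ℝ) (hN0 : N 0 = 1) (hN1 : N 1 = 1)
    (γ : ℝ) (hγ0 : 0 ≤ γ) (hγ1 : γ < 1)
    (f : ℝ → ℝ)
    (hfS : ∀ x y : ℝ, 0 ≤ x → 0 ≤ y → staircase F α l x = staircase F α l y → f x = f y)
    (hfD : ∀ x ∈ F, 0 ≤ x → ∃ d, HasFractalDerivWithinAt F α l (Set.Ici 0) f d x)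
    (hfI : ∀ T, 0 ≤ T →
      FractalIntegrable F α l (fractalDerivWithin F α l (Set.Ici 0) f) 0 T) :
    (∀ t, 0 ≤ t → FractalIntegrable F α l (wskIntegrand F α l γ 0 f t) 0 t) ∧
    (∀ v Lf : ℝ, 0 < staircase F α l v + γ / (1 - γ) → HasFractalLaplace F α l f v Lf →
      HasFractalLaplace F α l (wskDeriv F α l N γ 0 f) v
        (N γ / (1 - γ) *
          ((staircase F α l v * Lf - f 0) / (staircase F α l v + γ / (1 - γ))))) ∧
    (∀ v Sf : ℝ, 0 < 1 / staircase F α l v + γ / (1 - γ) → HasFractalSumudu F α l f v Sf →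
      HasFractalSumudu F α l (wskDeriv F α l N γ 0 f) v
        (N γ / (1 - γ) *
          ((Sf - f 0) / (1 + γ / (1 - γ) * staircase F α l v)))) :=
  theorem3p4_general F α l hα0 hF.1 hF.2.le hS0 hSinf N γ hγ1.ne f hfS hfD hfI
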